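/- Let $q\in\mathbb C$ with $0<|q|<1$, fix a square root $q^{1/2}$, and for $x\in\mathbb C$ let $z=x+\sqrt{x^2-1}$, where the branch satisfies $\sqrt{x^2-1}\sim x$ as $x\to\infty$, is cut along $[-1,1]$ and equals $i\sqrt{1-x^2}$ on the cut; thus $x=\frac12(z+z^{-1})$. Put $$\hat x=\tfrac12\big(q^{1/2}z+q^{-1/2}z^{-1}\big),\qquad \check x=\tfrac12\big(q^{-1/2}z+q^{1/2}z^{-1}\big),\qquad (\mathcal D_qf)(x)=\frac{f(\hat x)-f(\check x)}{\hat x-\check x}\quad(x\neq\pm1),$$ with $(\mathcal D_qf)(\pm1)$ defined by the limit. Let $m(r,f)=\frac1{2\pi}\int_0^{2\pi}\log^+|f(re^{i\theta})|\,d\theta$, $N(r,f=a)$ and $T(r,f)=m(r,f)+N(r,f=\infty)$ be the usual proximity function, integrated counting function (with multiplicity) and characteristic of Nevanlinna. For a meromorphic $f$ on $\mathbb C$ and $a\in\mathbb C$, let $\tilde n_{\mathrm{AW}}(r,f=a)$ be the sum of $h-k$ over all $x$ with $|x|<r$ and $f(x)=a$, where $h$ is the multiplicity of the $a$-point $x$,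 $k=\min\{h,k'\}$, and $k'$ is the multiplicity of $\hat x$ as a zero of $\mathcal D_qf$ ($k'=0$ if $\hat x$ is not a zero). Let $\tilde n_{\mathrm{AW}}(r,f=\infty)$ be the corresponding sum over the zeros of $1/f$, with $\mathcal D_qf$ replaced by $\mathcal D_q(1/f)$. For $a\in\widehat{\mathbb C}=\mathbb C\cup\{\infty\}$ put $$\tilde N_{\mathrm{AW}}(r,f=a)=\int_0^r\frac{\tilde n_{\mathrm{AW}}(t,f=a)-\tilde n_{\mathrm{AW}}(0,f=a)}{t}\,dt+\tilde n_{\mathrm{AW}}(0,f=a)\log r,$$ where $\tilde n_{\mathrm{AW}}(0,f=a)$ is the contribution of the point $x=0$, and $$\delta(a)=1-\limsup_{r\to\infty}\frac{N(r,f=a)}{T(r,f)},\quad \vartheta_{\mathrm{AW}}(a)=\liminf_{r\to\infty}\frac{N(r,f=a)-\tilde N_{\mathrm{AW}}(r,f=a)}{T(r,f)},\quad \Theta_{\mathrm{AW}}(a)=1-\limsup_{r\to\infty}\frac{\tilde N_{\mathrm{AW}}(r,f=a)}{T(r,f)}.$$ **Theorem.** Let $f$ be a transcendental meromorphic function on $\mathbb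 C$ of finite logarithmic order, that is, $\limsup_{r\to\infty}\frac{\log T(r,f)}{\log\log r}<+\infty$, and suppose $\mathcal D_qf\not\equiv0$. Then both sums below converge (absolutely), and $$\sum_{a\in\widehat{\mathbb C}}\big(\delta(a)+\vartheta_{\mathrm{AW}}(a)\big)\le\sum_{a\in\widehat{\mathbb C}}\Theta_{\mathrm{AW}}(a)\le2.$$ Moreover, $\{a\in\widehat{\mathbb C}:\Theta_{\mathrm{AW}}(a)>0\}$ is at most countable; that is, $f$ has at most countably many AW-deficient values. -/

import Mathlib

open Filter Topology

noncomputable section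

namespace AskeyWilson

/-!
Conventions. A meromorphic function on the plane is a function `f : ℂ → ℂ` with `Meromorphic f`; its
values at poles (and on any discrete set) are irrelevant for everything below. The extended plane of
possible values is `WithTop ℂ`, with `⊤` the point at infinity. The parameter `s` is a chosen square
root `q ^ (1/2)` of `q`. Proximity function, integrated counting function `N` and characteristic `T`
are Mathlib's `ValueDistribution.proximity`, `ValueDistribution.logCounting` and
`ValueDistribution.characteristic`; thus `T(r, f) = characteristic f ⊤ r` and
`N(r, f = a) = logCounting f a r`.
-/

/-- The solution `z = x + √(x² - 1)` of `x = (z + 1/z) / 2`, with the branch of the root that is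
asymptotic to `x` at infinity, cut along `[-1, 1]`, and equal to `i √(1 - x²)` on the cut. -/
def zOf (x : ℂ) : ℂ := x + (x - 1) ^ (1 / 2 : ℂ) * (x + 1) ^ (1 / 2 : ℂ)

/-- `x̂ = (q^{1/2} z + q^{-1/2} z⁻¹) / 2`. -/
def hat (s x : ℂ) : ℂ := (s * zOf x + s⁻¹ * (zOf x)⁻¹) / 2

/-- `x̌ = (q^{-1/2} z + q^{1/2} z⁻¹) / 2`. -/
def check (s x : ℂ) : ℂ := (s⁻¹ * zOf x + s * (zOf x)⁻¹) / 2

open Classical in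
/-- The Askey-Wilson divided difference operator `D_q`. At `x = ± 1`, where `x̂ = x̌`, it is defined
by the limiting value of the quotient. -/
def awOp (s : ℂ) (f : ℂ → ℂ) (x : ℂ) : ℂ :=
  if x = 1 ∨ x = -1 then deriv f (hat s x)
  else (f (hat s x) - f (check s x)) / (hat s x - check s x)

/-- `f` is a transcendental function: it does not agree with a rational function
(off a closed discrete set). -/
def IsTranscendental (f : ℂ → ℂ) : Prop :=
  ¬ ∃ P Q : Polynomial ℂ, Q ≠ 0 ∧ f =ᶠ[codiscrete ℂ] fun x => P.eval x / Q.eval x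

/-- The logarithmic order `limsup log T(r, f) / log log r`, as an extended real number. -/
def logOrder (f : ℂ → ℂ) : EReal :=
  limsup (fun r : ℝ => ((Real.log (ValueDistribution.characteristic f ⊤ r) /
    Real.log (Real.log r) : ℝ) : EReal)) atTop

/-- The multiplicity of `g` at `x` as a zero: the order of `g` at `x` if this is positive, and `0`
if `g` has a nonzero finite value or a pole at `x` (`⊤` if `g` vanishes identically near `x`). -/
def zeroMult (g : ℂ → ℂ) (x : ℂ) : WithTop ℤ := max 0 (meromorphicOrderAt g x)

/-- The Askey-Wilson counting divisor of the zeros of `g`, relative to a function `G`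
(which will be `D_q g`): the integer `h - k` at `x`, where `h` is the multiplicity of `x` as a zero
of `g`, `k = min h k'`, and `k'` is the multiplicity of `x̂` as a zero of `G`. -/
def awDivisor (s : ℂ) (g G : ℂ → ℂ) : Function.locallyFinsupp ℂ ℤ where
  toFun x := (MeromorphicOn.divisor g Set.univ)⁺ x -
    (min (((MeromorphicOn.divisor g Set.univ)⁺ x : ℤ) : WithTop ℤ) (zeroMult G (hat s x))).untop₀
  supportWithinDomain' := Set.subset_univ _
  supportLocallyFiniteWithinDomain' := by
    intro z hz
    obtain ⟨t, ht, hfin⟩ :=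
      ((MeromorphicOn.divisor g Set.univ)⁺).supportLocallyFiniteWithinDomain z hz
    refine ⟨t, ht, hfin.subset ?_⟩
    rintro x ⟨hxt, hx⟩
    refine ⟨hxt, fun h0 => hx ?_⟩
    have hk : (0 : WithTop ℤ) ≤ zeroMult G (hat s x) := le_max_left _ _
    simp [h0, min_eq_left hk]

/-- The Askey-Wilson integrated counting function of the `a`-points of `f`. For finite `a` these are
the zeros of `f - a`, compared with the zeros of `D_q f`; for `a = ∞` they are the zeros of `1 / f`,
compared with the zeros of `D_q (1 / f)`. -/
def awLogCounting (s : ℂ) (f : ℂ → ℂ) : WithTop ℂ → ℝ → ℝ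
  | some a => (awDivisor s (fun x => f x - a) (awOp s f)).logCounting
  | ⊤ => (awDivisor s (fun x => (f x)⁻¹) (awOp s (fun x => (f x)⁻¹))).logCounting

/-- The Nevanlinna deficiency `δ(a, f)`. -/
def deficiency (f : ℂ → ℂ) (a : WithTop ℂ) : ℝ :=
  1 - limsup (fun r : ℝ => ValueDistribution.logCounting f a r /
    ValueDistribution.characteristic f ⊤ r) atTop

/-- The Askey-Wilson multiplicity index `ϑ_AW(a, f)`. -/
def awMultIndex (s : ℂ) (f : ℂ → ℂ) (a : WithTop ℂ) : ℝ :=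
  liminf (fun r : ℝ => (ValueDistribution.logCounting f a r - awLogCounting s f a r) /
    ValueDistribution.characteristic f ⊤ r) atTop

/-- The Askey-Wilson deficiency `Θ_AW(a, f)`. -/
def awDeficiency (s : ℂ) (f : ℂ → ℂ) (a : WithTop ℂ) : ℝ :=
  1 - limsup (fun r : ℝ => awLogCounting s f a r /
    ValueDistribution.characteristic f ⊤ r) atTop

end AskeyWilson

end

namespace AskeyWilson

/-! ### The branch `zOf` -/

/-! The proof is Nevanlinna's, with `D_q f` in the role of `f'` and a difference quotient in the
role of the logarithmic derivative.

Analytic core, `IsShift.exists_circleAverage_posLog_le`: if `σ` is one of the shifts `x̂`, `x̌`, the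
circle mean of `log⁺ |f (σ x) / f x|` is `O((1 + T(r⁴)) / log r)`. On the disc of radius `r²` split
`f` into linear factors and a zero-free factor. The Poisson kernel shows that the logarithm of the
modulus of the zero-free factor hardly varies on `|x| ≤ K r`. There are `O((1 + T(r⁴)) / log r)`
linear factors, and each contributes `O(1)` uniformly in its root. This uniformity comes from `(x̂ -
u)(x̌ - u) = (x - û)(x - ǔ)`, which reduces circle means along the shifts to Jensen's formula.

Write `F = D_q f` and let `S` be a finite set of complex values. The usual argument gives `∑ m(r, a)
≤ m(r, f) - N(r, div F)` up to the error (`exists_sum_characteristic_sub_logCounting_le`). An order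
computation at `x = y̌` bounds the multiplicities left out of the AW count, including those at
infinity, by `div F` at `y` plus the poles of `f` at `y̌` and `ŷ` (`exists_sum_awExcess_le`).
Counting these poles at radius `K r` rather than `r` costs only the error again. Adding the two
estimates cancels `div F` and all terms `N(r, f = ∞)`, leaving `∑ (T - Ñ_AW(a)) ≤ 2 T + error` over
`S` together with infinity.

Finite logarithmic order yields `T(r⁴) ≤ C T(r)` for arbitrarily large `r`, and transcendence yields
`log r = o(T)`, so the error is `o(T)` along a sequence of radii. That is enough, since the
deficiencies are defined by a `limsup` of the counting functions. Finite sums of the nonnegative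
numbers `Θ_AW(a)` are therefore at most `2`, which gives summability and countability, while `δ +
ϑ_AW ≤ Θ_AW` holds for each value separately. -/

lemma cpow_half_sq (w : ℂ) : w ^ (1 / 2 : ℂ) * w ^ (1 / 2 : ℂ) = w := by
  have h := Complex.cpow_nat_inv_pow w (n := 2) (by norm_num)
  rw [← sq]
  simpa only [Nat.cast_ofNat, one_div] using h

lemma cpow_half_re_nonneg (w : ℂ) : 0 ≤ (w ^ (1 / 2 : ℂ)).re := by
  by_cases hw : w = 0
  · simp [hw]
  rw [Complex.cpow_def_of_ne_zero hw, Complex.exp_re]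
  refine mul_nonneg (Real.exp_pos _).le (Real.cos_nonneg_of_mem_Icc ?_)
  have h1 := Complex.neg_pi_lt_arg w
  have h2 := Complex.arg_le_pi w
  have : (Complex.log w * (1 / 2 : ℂ)).im = w.arg / 2 := by
    have : (1 / 2 : ℂ) = ((1 / 2 : ℝ) : ℂ) := by norm_num
    rw [this, Complex.im_mul_ofReal, Complex.log_im]; ring
  rw [this]
  constructor <;> linarith

lemma cpow_half_im (w : ℂ) : (0 ≤ w.im → 0 ≤ (w ^ (1 / 2 : ℂ)).im) ∧
    (w.im < 0 → (w ^ (1 / 2 : ℂ)).im ≤ 0) := by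
  by_cases hw : w = 0
  · simp [hw]
  have h1 := Complex.neg_pi_lt_arg w
  have h2 := Complex.arg_le_pi w
  have : (Complex.log w * (1 / 2 : ℂ)).im = w.arg / 2 := by
    have : (1 / 2 : ℂ) = ((1 / 2 : ℝ) : ℂ) := by norm_num
    rw [this, Complex.im_mul_ofReal, Complex.log_im]; ring
  rw [Complex.cpow_def_of_ne_zero hw, Complex.exp_im, this]
  refine ⟨fun h => ?_, fun h => ?_⟩
  · have := Complex.arg_nonneg_iff.2 h
    exact mul_nonneg (Real.exp_pos _).le
      (Real.sin_nonneg_of_nonneg_of_le_pi (by linarith) (by linarith))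
  · have := Complex.arg_neg_iff.2 h
    exact mul_nonpos_of_nonneg_of_nonpos (Real.exp_pos _).le
      (Real.sin_nonpos_of_nonpos_of_neg_pi_le (by linarith) (by linarith))

lemma zOf_mul_conj (x : ℂ) :
    zOf x * (x - (x - 1) ^ (1 / 2 : ℂ) * (x + 1) ^ (1 / 2 : ℂ)) = 1 := by
  have h1 := cpow_half_sq (x - 1)
  have h2 := cpow_half_sq (x + 1)
  unfold zOf
  generalize (x - 1) ^ (1 / 2 : ℂ) = a at *
  generalize (x + 1) ^ (1 / 2 : ℂ) = b at *
  linear_combination (-(b * b)) * h1 - (x - 1) * h2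

lemma zOf_ne_zero (x : ℂ) : zOf x ≠ 0 := left_ne_zero_of_mul_eq_one (zOf_mul_conj x)

lemma zOf_inv (x : ℂ) :
    (zOf x)⁻¹ = x - (x - 1) ^ (1 / 2 : ℂ) * (x + 1) ^ (1 / 2 : ℂ) :=
  inv_eq_of_mul_eq_one_right (zOf_mul_conj x)

lemma zOf_add_inv (x : ℂ) : zOf x + (zOf x)⁻¹ = 2 * x := by
  rw [zOf_inv, zOf]; ring

/-- With `a`, `b` the principal roots of `x - 1`, `x + 1`, one has `x ± a b = (a ± b)² / 2`, so
`|z⁻¹| ≤ |z|` amounts to `re a * re b + im a * im b ≥ 0`. Principal roots have nonnegative real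
part, and their imaginary parts have equal sign here because `x - 1` and `x + 1` have the same
imaginary part. -/
lemma one_le_norm_zOf (x : ℂ) : 1 ≤ ‖zOf x‖ := by
  have h1 := cpow_half_sq (x - 1)
  have h2 := cpow_half_sq (x + 1)
  have ra := cpow_half_re_nonneg (x - 1)
  have rb := cpow_half_re_nonneg (x + 1)
  have ia := cpow_half_im (x - 1)
  have ib := cpow_half_im (x + 1)
  have hm := zOf_mul_conj x
  unfold zOf at *
  generalize (x - 1) ^ (1 / 2 : ℂ) = a at *
  generalize (x + 1) ^ (1 / 2 : ℂ) = b at *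
  have iab : 0 ≤ a.im * b.im := by
    simp only [Complex.sub_im, Complex.add_im, Complex.one_im, sub_zero, add_zero] at ia ib
    rcases le_or_gt 0 x.im with h | h
    · exact mul_nonneg (ia.1 h) (ib.1 h)
    · exact mul_nonneg_of_nonpos_of_nonpos (ia.2 h) (ib.2 h)
  have hx : x = (a * a + b * b) / 2 := by rw [h1, h2]; ring
  have key : Complex.normSq (x - a * b) ≤ Complex.normSq (x + a * b) := by
    have e : Complex.normSq (x + a * b) - Complex.normSq (x - a * b) =
        2 * (a.re ^ 2 + a.im ^ 2 + b.re ^ 2 + b.im ^ 2) * (a.re * b.re + a.im * b.im) := by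
      rw [hx]
      have e1 : (a * a + b * b) / 2 + a * b = (a + b) * (a + b) / 2 := by ring
      have e2 : (a * a + b * b) / 2 - a * b = (a - b) * (a - b) / 2 := by ring
      rw [e1, e2]
      simp only [map_div₀, map_mul]
      simp only [Complex.normSq_apply, Complex.add_re, Complex.add_im, Complex.sub_re,
        Complex.sub_im, Complex.re_ofNat, Complex.im_ofNat]
      ring
    have := mul_nonneg (by positivity : 0 ≤ 2 * (a.re ^ 2 + a.im ^ 2 + b.re ^ 2 + b.im ^ 2))
      (add_nonneg (mul_nonneg ra rb) iab)
    linarith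
  have hn : Complex.normSq (x + a * b) * Complex.normSq (x - a * b) = 1 := by
    rw [← map_mul, hm, map_one]
  have hp := Complex.normSq_nonneg (x - a * b)
  have hq := Complex.normSq_nonneg (x + a * b)
  have : 1 ≤ Complex.normSq (x + a * b) := by nlinarith
  rw [Complex.normSq_eq_norm_sq] at this
  nlinarith [norm_nonneg (x + a * b)]

lemma eq_or_eq_inv_of_add_inv_eq {w v : ℂ} (hw : w ≠ 0) (hv : v ≠ 0)
    (h : w + w⁻¹ = v + v⁻¹) : w = v ∨ w = v⁻¹ := by
  have : (w - v) * (w - v⁻¹) = 0 := by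
    have e1 : w * w⁻¹ = 1 := mul_inv_cancel₀ hw
    have e2 : v * v⁻¹ = 1 := mul_inv_cancel₀ hv
    linear_combination w * h - e1 + e2
  rcases mul_eq_zero.1 this with h | h
  · exact Or.inl (sub_eq_zero.1 h)
  · exact Or.inr (sub_eq_zero.1 h)

lemma zOf_eq_or {x w : ℂ} (hw : w ≠ 0) (h : w + w⁻¹ = 2 * x) : zOf x = w ∨ zOf x = w⁻¹ :=
  eq_or_eq_inv_of_add_inv_eq (zOf_ne_zero x) hw (by rw [zOf_add_inv, h])

/-- The two solutions of `w + w⁻¹ = 2 x` are mutually inverse, and `zOf` never lies inside the unit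
disc. This is how `zOf` is evaluated at shifted points. -/
lemma zOf_eq {x w : ℂ} (hw : 1 < ‖w‖) (h : w + w⁻¹ = 2 * x) : zOf x = w := by
  have hw0 : w ≠ 0 := by rintro rfl; simp at hw; linarith
  rcases zOf_eq_or hw0 h with h | h
  · exact h
  · have := one_le_norm_zOf x
    rw [h, norm_inv] at this
    have h3 := inv_lt_one_of_one_lt₀ hw
    linarith

lemma norm_zOf_inv_le (x : ℂ) : ‖(zOf x)⁻¹‖ ≤ 1 := by
  rw [norm_inv]; exact inv_le_one_of_one_le₀ (one_le_norm_zOf x)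

lemma norm_zOf_le (x : ℂ) : ‖zOf x‖ ≤ 2 * ‖x‖ + 1 := by
  have h : zOf x = 2 * x - (zOf x)⁻¹ := by rw [← zOf_add_inv x]; ring
  rw [h]
  refine (norm_sub_le _ _).trans ?_
  have := norm_zOf_inv_le x
  simpa using this

lemma le_norm_zOf (x : ℂ) : 2 * ‖x‖ - 1 ≤ ‖zOf x‖ := by
  have h : 2 * x = zOf x + (zOf x)⁻¹ := by rw [← zOf_add_inv x]
  have h2 : ‖2 * x‖ ≤ ‖zOf x‖ + ‖(zOf x)⁻¹‖ := by rw [h]; exact norm_add_le _ _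
  have := norm_zOf_inv_le x
  have h3 : ‖2 * x‖ = 2 * ‖x‖ := by simp
  linarith

/-- `zOf` jumps across the cut. Normalising the radicand to be `1` at `x₀` keeps it off the slit of
the principal root, so an analytic branch exists near every point other than `±1`; it may agree with
`zOf` or with its inverse. -/
lemma exists_branch {x₀ : ℂ} (h1 : x₀ ≠ 1) (h2 : x₀ ≠ -1) :
    ∃ ζ : ℂ → ℂ, AnalyticAt ℂ ζ x₀ ∧ ζ x₀ = zOf x₀ ∧
      ∀ᶠ x in 𝓝 x₀, ζ x ≠ 0 ∧ ζ x + (ζ x)⁻¹ = 2 * x := by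
  set w₀ := zOf x₀ - x₀ with hw₀
  have hsq : w₀ * w₀ = x₀ ^ 2 - 1 := by
    have e := zOf_add_inv x₀
    have e2 : zOf x₀ * (zOf x₀)⁻¹ = 1 := mul_inv_cancel₀ (zOf_ne_zero x₀)
    rw [hw₀]
    linear_combination (zOf x₀) * e - e2
  have hne : w₀ ≠ 0 := by
    rintro h
    rw [h] at hsq
    have : (x₀ - 1) * (x₀ + 1) = 0 := by linear_combination -hsq
    rcases mul_eq_zero.1 this with h | h
    · exact h1 (sub_eq_zero.1 h)
    · exact h2 (eq_neg_of_add_eq_zero_left h)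
  have hmem : (x₀ ^ 2 - 1) / (w₀ * w₀) = 1 := by
    rw [hsq]; exact div_self (by rw [← hsq]; exact mul_ne_zero hne hne)
  refine ⟨fun x => x + w₀ * ((x ^ 2 - 1) / (w₀ * w₀)) ^ (1 / 2 : ℂ), ?_, ?_, ?_⟩
  · refine analyticAt_id.add (analyticAt_const.mul (AnalyticAt.cpow ?_ analyticAt_const ?_))
    · exact ((analyticAt_id.pow 2).sub analyticAt_const).div analyticAt_const
        (mul_ne_zero hne hne)
    · simp only [hmem]; exact Complex.one_mem_slitPlane
  · change x₀ + w₀ * ((x₀ ^ 2 - 1) / (w₀ * w₀)) ^ (1 / 2 : ℂ) = zOf x₀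
    rw [hmem, Complex.one_cpow, hw₀]; ring
  · refine Eventually.of_forall fun x => ?_
    dsimp only
    have h := cpow_half_sq ((x ^ 2 - 1) / (w₀ * w₀))
    generalize ((x ^ 2 - 1) / (w₀ * w₀)) ^ (1 / 2 : ℂ) = c at *
    rw [eq_div_iff (mul_ne_zero hne hne)] at h
    have hm : (x + w₀ * c) * (x - w₀ * c) = 1 := by linear_combination -h
    refine ⟨left_ne_zero_of_mul_eq_one hm, ?_⟩
    rw [inv_eq_of_mul_eq_one_right hm]; ring

lemma one_lt_norm_zOf {x : ℂ} (hx : 1 < ‖x‖) : 1 < ‖zOf x‖ := by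
  have := le_norm_zOf x
  linarith

lemma analyticAt_zOf {x₀ : ℂ} (hx : 1 < ‖x₀‖) : AnalyticAt ℂ zOf x₀ := by
  have h1 : x₀ ≠ 1 := by rintro rfl; simp at hx
  have h2 : x₀ ≠ -1 := by rintro rfl; simp at hx
  obtain ⟨ζ, hζ, hζ0, hev⟩ := exists_branch h1 h2
  refine hζ.congr ?_
  have h3 : ∀ᶠ x in 𝓝 x₀, 1 < ‖ζ x‖ :=
    hζ.continuousAt.norm.eventually_const_lt (by
      change 1 < ‖ζ x₀‖
      rw [hζ0]; exact one_lt_norm_zOf hx)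
  filter_upwards [hev, h3] with x hx1 hx2
  exact (zOf_eq hx2 hx1.2).symm

/-! ### The shifts `hat` and `check` -/

lemma hat_add_check (s x : ℂ) : hat s x + check s x = (s + s⁻¹) * x := by
  have := zOf_add_inv x
  unfold hat check
  linear_combination (s + s⁻¹) / 2 * this

lemma hat_mul_check {s : ℂ} (hs : s ≠ 0) (x : ℂ) :
    hat s x * check s x = x ^ 2 + (s - s⁻¹) ^ 2 / 4 := by
  have e := zOf_add_inv x
  have e1 : zOf x * (zOf x)⁻¹ = 1 := mul_inv_cancel₀ (zOf_ne_zero x)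
  have e2 : s * s⁻¹ = 1 := mul_inv_cancel₀ hs
  unfold hat check
  generalize (zOf x)⁻¹ = w at *
  generalize zOf x = z at *
  generalize s⁻¹ = t at *
  have e3 : x = (z + w) / 2 := by rw [e]; ring
  rw [e3]
  linear_combination (z ^ 2 + w ^ 2) / 4 * e2 + (s ^ 2 + t ^ 2 - 2) / 4 * e1 + (e2 / 2)

/-- Both sides expand to `x² + u² - (s + s⁻¹) x u + (s - s⁻¹)² / 4`, which is symmetric in `x` and
`u`. The right side is a polynomial in `x` with explicit roots, to which Jensen's formula applies.
-/
lemma hat_sub_mul_check_sub {s : ℂ} (hs : s ≠ 0) (x u : ℂ) :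
    (hat s x - u) * (check s x - u) = (x - hat s u) * (x - check s u) := by
  have h1 := hat_add_check s x
  have h2 := hat_mul_check hs x
  have h3 := hat_add_check s u
  have h4 := hat_mul_check hs u
  linear_combination h2 - u * h1 - h4 + x * h3

lemma hat_sub_check (s x : ℂ) : hat s x - check s x = (s - s⁻¹) * (zOf x - (zOf x)⁻¹) / 2 := by
  unfold hat check; ring

/-- No lower bound on `x` is needed: `s⁻¹ z` always lies outside the unit disc. In the opposite
order `s z` may fall inside, whence the hypothesis of `check_hat`. -/
lemma hat_check {s : ℂ} (hs : s ≠ 0) (hs1 : ‖s‖ < 1) (x : ℂ) : hat s (check s x) = x := by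
  have hz : zOf (check s x) = s⁻¹ * zOf x := by
    apply zOf_eq
    · rw [norm_mul, norm_inv]
      have h1 := one_le_norm_zOf x
      have h2 : 1 < ‖s‖⁻¹ := (one_lt_inv₀ (norm_pos_iff.2 hs)).2 hs1
      nlinarith
    · unfold check; rw [mul_inv, inv_inv]; ring
  unfold hat
  rw [hz, mul_inv, inv_inv, ← mul_assoc, ← mul_assoc, mul_inv_cancel₀ hs, inv_mul_cancel₀ hs,
    one_mul, one_mul, zOf_add_inv]; ring

lemma check_hat {s : ℂ} (hs : s ≠ 0) {x : ℂ} (hx : ‖s‖⁻¹ + 1 < 2 * ‖x‖) :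
    check s (hat s x) = x := by
  have hs0 := norm_pos_iff.2 hs
  have hz : zOf (hat s x) = s * zOf x := by
    apply zOf_eq
    · rw [norm_mul]
      have h1 := le_norm_zOf x
      calc (1 : ℝ) = ‖s‖ * ‖s‖⁻¹ := (mul_inv_cancel₀ hs0.ne').symm
        _ < ‖s‖ * ‖zOf x‖ := by gcongr; linarith
    · unfold hat; rw [mul_inv]; ring
  unfold check
  rw [hz, mul_inv, ← mul_assoc, ← mul_assoc, mul_inv_cancel₀ hs, inv_mul_cancel₀ hs,
    one_mul, one_mul, zOf_add_inv]; ring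

lemma norm_hat_le (s x : ℂ) : ‖hat s x‖ ≤ ‖s‖ * ‖x‖ + (‖s‖ + ‖s‖⁻¹) / 2 := by
  have h1 := norm_zOf_le x
  have h2 := norm_zOf_inv_le x
  unfold hat
  rw [norm_div, Complex.norm_ofNat]
  have h3 := norm_add_le (s * zOf x) (s⁻¹ * (zOf x)⁻¹)
  rw [norm_mul, norm_mul, norm_inv s] at h3
  have h4 : ‖s‖ * ‖zOf x‖ ≤ ‖s‖ * (2 * ‖x‖ + 1) := by gcongr
  have h5 : ‖s‖⁻¹ * ‖(zOf x)⁻¹‖ ≤ ‖s‖⁻¹ * 1 := by gcongr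
  linarith

lemma norm_check_le (s x : ℂ) : ‖check s x‖ ≤ ‖s‖⁻¹ * ‖x‖ + (‖s‖ + ‖s‖⁻¹) / 2 := by
  have h1 := norm_zOf_le x
  have h2 := norm_zOf_inv_le x
  unfold check
  rw [norm_div, Complex.norm_ofNat]
  have h3 := norm_add_le (s⁻¹ * zOf x) (s * (zOf x)⁻¹)
  rw [norm_mul, norm_mul, norm_inv s] at h3
  have h4 : ‖s‖⁻¹ * ‖zOf x‖ ≤ ‖s‖⁻¹ * (2 * ‖x‖ + 1) := by gcongr
  have h5 : ‖s‖ * ‖(zOf x)⁻¹‖ ≤ ‖s‖ * 1 := by gcongr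
  linarith

lemma le_norm_hat (s x : ℂ) : ‖s‖ * ‖x‖ - (‖s‖ + ‖s‖⁻¹) / 2 ≤ ‖hat s x‖ := by
  have h1 := le_norm_zOf x
  have h2 := norm_zOf_inv_le x
  unfold hat
  rw [norm_div, Complex.norm_ofNat]
  have h3 := norm_sub_le_norm_add (s * zOf x) (s⁻¹ * (zOf x)⁻¹)
  rw [norm_mul, norm_mul, norm_inv s] at h3
  have h4 : ‖s‖ * (2 * ‖x‖ - 1) ≤ ‖s‖ * ‖zOf x‖ := by gcongr
  have h5 : ‖s‖⁻¹ * ‖(zOf x)⁻¹‖ ≤ ‖s‖⁻¹ * 1 := by gcongr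
  linarith

lemma le_norm_check (s x : ℂ) : ‖s‖⁻¹ * ‖x‖ - (‖s‖ + ‖s‖⁻¹) / 2 ≤ ‖check s x‖ := by
  have h1 := le_norm_zOf x
  have h2 := norm_zOf_inv_le x
  unfold check
  rw [norm_div, Complex.norm_ofNat]
  have h3 := norm_sub_le_norm_add (s⁻¹ * zOf x) (s * (zOf x)⁻¹)
  rw [norm_mul, norm_mul, norm_inv s] at h3
  have h4 : ‖s‖⁻¹ * (2 * ‖x‖ - 1) ≤ ‖s‖⁻¹ * ‖zOf x‖ := by gcongr
  have h5 : ‖s‖ * ‖(zOf x)⁻¹‖ ≤ ‖s‖ * 1 := by gcongr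
  linarith

lemma le_norm_hat_sub_check (s x : ℂ) :
    ‖s - s⁻¹‖ * (‖x‖ - 1) ≤ ‖hat s x - check s x‖ := by
  have h1 := le_norm_zOf x
  have h2 := norm_zOf_inv_le x
  rw [hat_sub_check, norm_div, Complex.norm_ofNat, norm_mul]
  have h3 := norm_sub_norm_le (zOf x) (zOf x)⁻¹
  have : ‖s - s⁻¹‖ * (2 * ‖x‖ - 2) ≤ ‖s - s⁻¹‖ * ‖zOf x - (zOf x)⁻¹‖ := by
    gcongr; linarith
  linarith

lemma sub_inv_ne_zero {s : ℂ} (hs : s ≠ 0) (hs1 : ‖s‖ < 1) : s - s⁻¹ ≠ 0 := by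
  intro h
  have h2 : s = s⁻¹ := sub_eq_zero.1 h
  have h3 : ‖s‖ = ‖s‖⁻¹ := by rw [← norm_inv, ← h2]
  have h4 : 1 < ‖s‖⁻¹ := (one_lt_inv₀ (norm_pos_iff.2 hs)).2 hs1
  linarith

lemma analyticAt_hat {s x : ℂ} (hx : 1 < ‖x‖) : AnalyticAt ℂ (hat s) x :=
  (((analyticAt_const.mul (analyticAt_zOf hx)).add
    (analyticAt_const.mul ((analyticAt_zOf hx).inv (zOf_ne_zero x)))).div analyticAt_const
    two_ne_zero)

lemma analyticAt_check {s x : ℂ} (hx : 1 < ‖x‖) : AnalyticAt ℂ (check s) x :=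
  (((analyticAt_const.mul (analyticAt_zOf hx)).add
    (analyticAt_const.mul ((analyticAt_zOf hx).inv (zOf_ne_zero x)))).div analyticAt_const
    two_ne_zero)

/-- A map with an analytic left inverse has nonvanishing derivative. -/
lemma deriv_ne_zero_of_leftInverse {g h : ℂ → ℂ} {x : ℂ} (hg : DifferentiableAt ℂ g x)
    (hh : DifferentiableAt ℂ h (g x)) (hgh : ∀ᶠ y in 𝓝 x, h (g y) = y) : deriv g x ≠ 0 := by
  intro h0
  have h1 : HasDerivAt (h ∘ g) (deriv h (g x) * deriv g x) x := hh.hasDerivAt.comp x hg.hasDerivAt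
  have h2 : HasDerivAt (h ∘ g) 1 x := (hasDerivAt_id x).congr_of_eventuallyEq hgh
  have := h1.unique h2
  rw [h0, mul_zero] at this
  exact zero_ne_one this

lemma deriv_check_ne_zero {s x : ℂ} (hs : s ≠ 0) (hs1 : ‖s‖ < 1) (hx : 1 < ‖x‖)
    (hx' : 1 < ‖check s x‖) : deriv (check s) x ≠ 0 :=
  deriv_ne_zero_of_leftInverse (h := hat s) (analyticAt_check hx).differentiableAt
    (analyticAt_hat hx').differentiableAt (Eventually.of_forall (hat_check hs hs1))

lemma deriv_hat_ne_zero {s x : ℂ} (hs : s ≠ 0) (hx : 1 < ‖x‖) (hx2 : ‖s‖⁻¹ + 1 < 2 * ‖x‖)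
    (hx' : 1 < ‖hat s x‖) : deriv (hat s) x ≠ 0 := by
  refine deriv_ne_zero_of_leftInverse (h := check s) (analyticAt_hat hx).differentiableAt
    (analyticAt_check hx').differentiableAt ?_
  have : ∀ᶠ y in 𝓝 x, ‖s‖⁻¹ + 1 < 2 * ‖y‖ :=
    (continuousAt_const.mul continuous_norm.continuousAt).eventually_const_lt hx2
  filter_upwards [this] with y hy
  exact check_hat hs hy

/-! ### Meromorphy of the Askey-Wilson operator -/

/-- The Askey-Wilson divided difference in the uniformizing variable `z`. -/
noncomputable def awSym (s : ℂ) (f : ℂ → ℂ) (z : ℂ) : ℂ :=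
  (f ((s * z + s⁻¹ * z⁻¹) / 2) - f ((s⁻¹ * z + s * z⁻¹) / 2)) /
    ((s * z + s⁻¹ * z⁻¹) / 2 - (s⁻¹ * z + s * z⁻¹) / 2)

/-- Inverting `z` exchanges the two evaluation points. Hence the choice between the two branches of
`z` is immaterial, and `D_q f` is meromorphic across the cut although the shifts are not continuous
there. -/
lemma awSym_inv (s : ℂ) (f : ℂ → ℂ) (z : ℂ) : awSym s f z⁻¹ = awSym s f z := by
  unfold awSym
  rw [inv_inv, add_comm (s * z⁻¹), add_comm (s⁻¹ * z⁻¹), ← neg_div_neg_eq, neg_sub, neg_sub]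

lemma awOp_eq_awSym {s : ℂ} {f : ℂ → ℂ} {x : ℂ} (h1 : x ≠ 1) (h2 : x ≠ -1) :
    awOp s f x = awSym s f (zOf x) := by
  unfold awOp awSym hat check
  rw [if_neg (by tauto)]

lemma meromorphicAt_awSym {s : ℂ} {f : ℂ → ℂ} (hf : Meromorphic f) {z : ℂ} (hz : z ≠ 0) :
    MeromorphicAt (awSym s f) z := by
  have ha : ∀ a b : ℂ, AnalyticAt ℂ (fun z : ℂ => (a * z + b * z⁻¹) / 2) z := fun a b =>
    ((analyticAt_const.mul analyticAt_id).add (analyticAt_const.mul (analyticAt_id.inv hz))).div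
      analyticAt_const two_ne_zero
  exact (((hf _).comp_analyticAt (ha s s⁻¹)).sub ((hf _).comp_analyticAt (ha s⁻¹ s))).div
    ((ha s s⁻¹).meromorphicAt.sub (ha s⁻¹ s).meromorphicAt)

lemma exists_awOp_eventuallyEq {s : ℂ} {f : ℂ → ℂ} {x₀ : ℂ} (h1 : x₀ ≠ 1) (h2 : x₀ ≠ -1) :
    ∃ ζ : ℂ → ℂ, AnalyticAt ℂ ζ x₀ ∧ ζ x₀ = zOf x₀ ∧ awOp s f =ᶠ[𝓝 x₀] awSym s f ∘ ζ := by
  obtain ⟨ζ, hζ, hζ0, hev⟩ := exists_branch h1 h2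
  refine ⟨ζ, hζ, hζ0, ?_⟩
  filter_upwards [hev, isOpen_ne.mem_nhds h1, isOpen_ne.mem_nhds h2] with x hx hx1 hx2
  rw [awOp_eq_awSym hx1 hx2, Function.comp_apply]
  rcases zOf_eq_or hx.1 hx.2 with h | h <;> rw [h]
  rw [awSym_inv]

/-- A function that is holomorphic and of polynomial growth on a punctured neighbourhood of a point
is meromorphic there. -/
lemma meromorphicAt_of_bounded {g : ℂ → ℂ} {c : ℂ} {n : ℕ} {C : ℝ}
    (hd : ∀ᶠ x in 𝓝[≠] c, DifferentiableAt ℂ g x)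
    (hb : ∀ᶠ x in 𝓝[≠] c, ‖(x - c) ^ n * g x‖ ≤ C) : MeromorphicAt g c := by
  set h : ℂ → ℂ := fun x => (x - c) ^ n * g x with hh
  have hd' : ∀ᶠ x in 𝓝[≠] c, DifferentiableAt ℂ h x := by
    filter_upwards [hd] with x hx
    fun_prop
  have ht := Complex.tendsto_limUnder_of_differentiable_on_punctured_nhds_of_bounded_under hd' (by
    refine ⟨C + ‖h c‖, ?_⟩
    rw [eventually_map]
    filter_upwards [hb] with x hx
    exact (norm_sub_le _ _).trans (by gcongr))
  have han : AnalyticAt ℂ (Function.update h c (limUnder (𝓝[≠] c) h)) c := by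
    refine Complex.analyticAt_of_differentiable_on_punctured_nhds_of_continuousAt ?_
      (continuousAt_update_same.2 ht)
    filter_upwards [hd', self_mem_nhdsWithin] with x hx hxc
    refine hx.congr_of_eventuallyEq ?_
    filter_upwards [isOpen_ne.mem_nhds hxc] with y hy
    exact Function.update_of_ne hy _ _
  have hmer : MeromorphicAt h c := by
    refine han.meromorphicAt.congr ?_
    filter_upwards [self_mem_nhdsWithin] with x hx
    exact Function.update_of_ne hx _ _
  have hm2 : MeromorphicAt (fun x => ((x - c) ^ n)⁻¹ * h x) c := by fun_prop
  refine hm2.congr ?_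
  filter_upwards [self_mem_nhdsWithin] with x hx
  have : (x - c) ^ n ≠ 0 := pow_ne_zero _ (sub_ne_zero.2 hx)
  rw [hh]; field_simp

lemma zOf_sub_sq {e x : ℂ} (he : e * e = 1) : (zOf x - e) ^ 2 = 2 * zOf x * (x - e) := by
  have h := zOf_add_inv x
  have h2 : zOf x * (zOf x)⁻¹ = 1 := mul_inv_cancel₀ (zOf_ne_zero x)
  linear_combination (zOf x) * h - h2 + he

lemma tendsto_zOf {e : ℂ} (he : e * e = 1) : Tendsto zOf (𝓝[≠] e) (𝓝[≠] e) := by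
  refine tendsto_nhdsWithin_iff.2 ⟨?_, ?_⟩
  · rw [tendsto_iff_norm_sub_tendsto_zero]
    have h0 : Tendsto (fun x : ℂ => √(2 * (2 * ‖x‖ + 1) * ‖x - e‖)) (𝓝[≠] e) (𝓝 0) := by
      have : Continuous fun x : ℂ => √(2 * (2 * ‖x‖ + 1) * ‖x - e‖) := by fun_prop
      have h := this.tendsto e
      simp only [sub_self, norm_zero, mul_zero, Real.sqrt_zero] at h
      exact h.mono_left nhdsWithin_le_nhds
    refine squeeze_zero (fun _ => norm_nonneg _) (fun x => ?_) h0
    refine Real.le_sqrt_of_sq_le ?_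
    rw [← norm_pow, zOf_sub_sq he, norm_mul, norm_mul, Complex.norm_ofNat]
    gcongr
    exact norm_zOf_le x
  · filter_upwards [self_mem_nhdsWithin] with x hx hz
    apply hx
    have h := zOf_sub_sq (x := x) he
    rw [Set.mem_singleton_iff] at hz ⊢
    rw [hz, sub_self] at h
    have he0 : e ≠ 0 := left_ne_zero_of_mul_eq_one he
    have : (2 * e) * (x - e) = 0 := by rw [← h]; ring
    exact sub_eq_zero.1 ((mul_eq_zero.1 this).resolve_left (by simp [he0]))

/-- At a branch point `e = ±1` no analytic branch of `z` exists. But `(z - e)² = 2 z (x - e)` gives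
`|x - e| ≤ |z - e|` nearby, so the exponent that makes `awSym` bounded at `e` in the variable `z`
also works for `D_q f` in the variable `x`, and the singularity is at worst a pole. -/
lemma meromorphicAt_awOp_of_sq_eq_one {s : ℂ} {f : ℂ → ℂ} (hf : Meromorphic f) {e : ℂ}
    (he : e * e = 1) : MeromorphicAt (awOp s f) e := by
  have he0 : e ≠ 0 := left_ne_zero_of_mul_eq_one he
  have hm := meromorphicAt_awSym (s := s) hf he0
  have hne : ∀ᶠ x in 𝓝[≠] e, x ≠ 1 ∧ x ≠ -1 := by
    have h1 : (1 : ℂ) ≠ -1 := by norm_num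
    have : e = 1 ∨ e = -1 := mul_self_eq_one_iff.1 he
    rcases this with rfl | rfl
    · filter_upwards [self_mem_nhdsWithin, nhdsWithin_le_nhds (isOpen_ne.mem_nhds h1)]
        with x hx hx2 using ⟨hx, hx2⟩
    · filter_upwards [self_mem_nhdsWithin, nhdsWithin_le_nhds (isOpen_ne.mem_nhds h1.symm)]
        with x hx hx2 using ⟨hx2, hx⟩
  obtain ⟨n, hn⟩ := id hm
  have hbound : ∀ᶠ z in 𝓝[≠] e, ‖(z - e) ^ n • awSym s f z‖ ≤ ‖(e - e) ^ n • awSym s f e‖ + 1 :=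
    nhdsWithin_le_nhds ((hn.continuousAt.norm).eventually_le_const (lt_add_one _))
  have hsmall : ∀ᶠ x in 𝓝[≠] e, ‖zOf x - e‖ ≤ 1 := by
    have h := ((tendsto_zOf he).mono_right nhdsWithin_le_nhds)
    rw [tendsto_iff_norm_sub_tendsto_zero] at h
    exact h.eventually_le_const one_pos
  refine meromorphicAt_of_bounded (n := n) (C := ‖(e - e) ^ n • awSym s f e‖ + 1) ?_ ?_
  · filter_upwards [hne, (tendsto_zOf he).eventually (MeromorphicAt.eventually_analyticAt hm)] with x hx hx2
    obtain ⟨ζ, hζ, hζ0, hev⟩ := exists_awOp_eventuallyEq (s := s) (f := f) hx.1 hx.2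
    rw [← hζ0] at hx2
    exact ((hx2.comp hζ).congr hev.symm).differentiableAt
  · filter_upwards [hne, (tendsto_zOf he).eventually hbound, hsmall] with x hx hx2 hx3
    refine le_trans ?_ hx2
    rw [awOp_eq_awSym hx.1 hx.2, norm_mul, norm_smul, norm_pow, norm_pow]
    gcongr
    have h := congrArg norm (zOf_sub_sq (x := x) he)
    rw [norm_pow, norm_mul, norm_mul, Complex.norm_ofNat] at h
    have h1 := one_le_norm_zOf x
    have h2 := norm_nonneg (x - e)
    have h3 := norm_nonneg (zOf x - e)
    nlinarith

lemma meromorphic_awOp {s : ℂ} {f : ℂ → ℂ} (hf : Meromorphic f) : Meromorphic (awOp s f) := by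
  intro x
  by_cases h1 : x = 1
  · exact meromorphicAt_awOp_of_sq_eq_one hf (by rw [h1]; norm_num)
  by_cases h2 : x = -1
  · exact meromorphicAt_awOp_of_sq_eq_one hf (by rw [h2]; norm_num)
  obtain ⟨ζ, hζ, hζ0, hev⟩ := exists_awOp_eventuallyEq (s := s) (f := f) h1 h2
  have : MeromorphicAt (awSym s f) (ζ x) := meromorphicAt_awSym hf (by rw [hζ0]; exact zOf_ne_zero x)
  exact (this.comp_analyticAt hζ).congr (hev.symm.filter_mono nhdsWithin_le_nhds)

/-! ### Counting functions of divisors -/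

/-- The weight with which a point `z` enters the logarithmic counting function. -/
noncomputable def countWeight (r : ℝ) (z : ℂ) : ℝ :=
  if z = 0 then Real.log r else max 0 (Real.log (r * ‖z‖⁻¹))

lemma countWeight_nonneg {r : ℝ} (hr : 1 ≤ r) (z : ℂ) : 0 ≤ countWeight r z := by
  unfold countWeight
  split_ifs
  · exact Real.log_nonneg hr
  · exact le_max_left _ _

lemma countWeight_mul_le {r K : ℝ} (hr : 1 ≤ r) (hK : 1 ≤ K) (z : ℂ) :
    countWeight (K * r) z ≤ countWeight r z + Real.log K := by
  unfold countWeight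
  split_ifs with h
  · rw [Real.log_mul (by positivity) (by positivity)]; linarith
  · have hz : 0 < ‖z‖⁻¹ := inv_pos.2 (norm_pos_iff.2 h)
    rw [mul_assoc, Real.log_mul (x := K) (by positivity) (by positivity)]
    have := Real.log_nonneg hK
    refine max_le ?_ ?_
    · linarith [le_max_left 0 (Real.log (r * ‖z‖⁻¹))]
    · linarith [le_max_right 0 (Real.log (r * ‖z‖⁻¹))]

lemma log_le_countWeight_sq {R : ℝ} (hR : 1 ≤ R) {z : ℂ} (hz : ‖z‖ ≤ R) :
    Real.log R ≤ countWeight (R ^ 2) z := by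
  unfold countWeight
  have := Real.log_nonneg hR
  split_ifs with h
  · rw [Real.log_pow]; push_cast; linarith
  · refine le_trans (Real.log_le_log (by positivity) ?_) (le_max_right _ _)
    have hz0 : 0 < ‖z‖ := norm_pos_iff.2 h
    rw [← div_eq_mul_inv, le_div_iff₀ hz0]
    nlinarith

lemma countWeight_le_countWeight {r K : ℝ} (hr : 0 < r) {x y : ℂ} (hx : x ≠ 0)
    (hy : y ≠ 0) (hxy : ‖x‖ ≤ K * ‖y‖) : countWeight r y ≤ countWeight (K * r) x := by
  unfold countWeight
  rw [if_neg hx, if_neg hy]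
  have hx0 : 0 < ‖x‖ := norm_pos_iff.2 hx
  have hy0 : 0 < ‖y‖ := norm_pos_iff.2 hy
  refine max_le_max le_rfl (Real.log_le_log (by positivity) ?_)
  rw [← div_eq_mul_inv, ← div_eq_mul_inv, div_le_div_iff₀ hy0 hx0]
  nlinarith

lemma finite_ball_support (D : Function.locallyFinsupp ℂ ℤ) (R : ℝ) :
    {z : ℂ | ‖z‖ ≤ R ∧ D z ≠ 0}.Finite := by
  have := D.locallyFiniteSupport.finite_inter_support_of_isCompact
    (isCompact_closedBall (0 : ℂ) R)
  refine this.subset ?_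
  rintro z ⟨hz, hD⟩
  exact ⟨by simpa using hz, hD⟩

/-- `countWeight r` vanishes at points outside the disc of radius `r`, so any finite set containing
the relevant support may be used. Divisors and radii can then be compared term by term over a common
set. -/
lemma logCounting_eq_sum (D : Function.locallyFinsupp ℂ ℤ) {r : ℝ} (hr : 0 ≤ r) (Z : Finset ℂ)
    (hZ : ∀ z, ‖z‖ ≤ r → D z ≠ 0 → z ∈ Z) :
    D.logCounting r = ∑ z ∈ Z, (D z : ℝ) * countWeight r z := by
  change ∑ᶠ z, (D.toClosedBall r z : ℝ) * Real.log (r * ‖z‖⁻¹) + (D 0 : ℝ) * Real.log r = _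
  have hball : ∀ z : ℂ, ‖z‖ ≤ r → D.toClosedBall r z = D z := fun z hz =>
    Function.locallyFinsuppWithin.toClosedBall_eval_within D (by simpa [abs_of_nonneg hr] using hz)
  have hout : ∀ z : ℂ, r < ‖z‖ → D.toClosedBall r z = 0 := fun z hz =>
    Function.locallyFinsuppWithin.apply_eq_zero_of_notMem _
      (by simpa [abs_of_nonneg hr] using hz)
  have h0 : (D 0 : ℝ) * Real.log r = ∑ z ∈ Z, if z = 0 then (D 0 : ℝ) * Real.log r else 0 := by
    rw [Finset.sum_ite_eq' Z (0 : ℂ)]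
    split_ifs with h
    · rfl
    · have : D 0 = 0 := by
        by_contra h'
        exact h (hZ 0 (by simpa using hr) h')
      simp [this]
  rw [finsum_eq_sum_of_support_subset (s := Z), h0, ← Finset.sum_add_distrib]
  · refine Finset.sum_congr rfl fun z _ => ?_
    unfold countWeight
    by_cases hz : z = 0
    · simp [hz]
    · rw [if_neg hz, if_neg hz, add_zero]
      rcases le_or_gt ‖z‖ r with h | h
      · rw [hball z h, max_eq_right]
        refine Real.log_nonneg ?_
        rw [← div_eq_mul_inv]
        exact (one_le_div (norm_pos_iff.2 hz)).2 h
      · have : Real.log (r * ‖z‖⁻¹) ≤ 0 := by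
          refine Real.log_nonpos (by positivity) ?_
          rw [← div_eq_mul_inv]
          exact div_le_one_of_le₀ h.le (norm_nonneg _)
        rw [hout z h, max_eq_left this]; simp
  · intro z hz
    rw [Function.mem_support] at hz
    have h1 : D.toClosedBall r z ≠ 0 := by
      intro h; apply hz; simp [h]
    have h2 : ‖z‖ ≤ r := by
      by_contra h; exact h1 (hout z (not_le.1 h))
    exact hZ z h2 (by rwa [hball z h2] at h1)

lemma logCounting_eq_sum_toFinset (D : Function.locallyFinsupp ℂ ℤ) {r R : ℝ} (hr : 0 ≤ r)
    (hrR : r ≤ R) :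
    D.logCounting r = ∑ z ∈ (finite_ball_support D R).toFinset, (D z : ℝ) * countWeight r z :=
  logCounting_eq_sum D hr _ fun z hz hD => by simp [hz.trans hrR, hD]

/-- The number of points in a disc is controlled by the logarithmic counting function at the
square of the radius. -/
lemma sum_mul_log_le {D : Function.locallyFinsupp ℂ ℤ} (hD : 0 ≤ D) {R : ℝ} (hR : 1 ≤ R) :
    (∑ z ∈ (finite_ball_support D R).toFinset, (D z : ℝ)) * Real.log R ≤ D.logCounting (R ^ 2) := by
  have hR2 : R ≤ R ^ 2 := by nlinarith
  rw [logCounting_eq_sum_toFinset D (r := R ^ 2) (by positivity) le_rfl, Finset.sum_mul]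
  have hnn : ∀ z, (0 : ℝ) ≤ D z := fun z => by exact_mod_cast hD z
  refine le_trans (Finset.sum_le_sum fun z hz => ?_)
    (Finset.sum_le_sum_of_subset_of_nonneg (fun z hz => ?_)
      fun z _ _ => mul_nonneg (hnn z) (countWeight_nonneg (by nlinarith) z))
  · simp only [Set.Finite.mem_toFinset, Set.mem_ofPred_eq] at hz
    exact mul_le_mul_of_nonneg_left (log_le_countWeight_sq hR hz.1) (hnn z)
  · simp only [Set.Finite.mem_toFinset, Set.mem_ofPred_eq] at hz ⊢
    exact ⟨hz.1.trans hR2, hz.2⟩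

/-- Enlarging the radius by the factor `K` raises each weight by at most `log K`. Only points with
`|z| ≤ r²` occur, and their number is bounded by the counting function at `r⁴`, by `sum_mul_log_le`.
-/
lemma logCounting_mul_le {D : Function.locallyFinsupp ℂ ℤ} (hD : 0 ≤ D) {r K : ℝ} (hr : 1 < r)
    (hK : 1 ≤ K) (hKr : K ≤ r) :
    D.logCounting (K * r) ≤ D.logCounting r + Real.log K * (D.logCounting (r ^ 4) / Real.log r) := by
  have hnn : ∀ z, (0 : ℝ) ≤ D z := fun z => by exact_mod_cast hD z
  have hrr : K * r ≤ r ^ 2 := by nlinarith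
  have hr2 : r ≤ r ^ 2 := by nlinarith
  rw [logCounting_eq_sum_toFinset D (r := K * r) (R := r ^ 2) (by positivity) hrr,
    logCounting_eq_sum_toFinset D (r := r) (R := r ^ 2) (by positivity) hr2]
  have h1 := sum_mul_log_le hD (R := r ^ 2) (by nlinarith)
  set Z := (finite_ball_support D (r ^ 2)).toFinset
  have h2 : ∑ z ∈ Z, (D z : ℝ) * countWeight (K * r) z ≤
      ∑ z ∈ Z, (D z : ℝ) * countWeight r z + Real.log K * ∑ z ∈ Z, (D z : ℝ) := by
    rw [Finset.mul_sum, ← Finset.sum_add_distrib]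
    refine Finset.sum_le_sum fun z _ => ?_
    have := mul_le_mul_of_nonneg_left (countWeight_mul_le hr.le hK z) (hnn z)
    linarith
  refine h2.trans ?_
  gcongr
  · exact Real.log_nonneg hK
  have hlog := Real.log_pos hr
  rw [le_div_iff₀ hlog]
  have hs : 0 ≤ ∑ z ∈ Z, (D z : ℝ) := Finset.sum_nonneg fun z _ => hnn z
  rw [Real.log_pow, show (r ^ 2) ^ 2 = r ^ 4 by ring] at h1
  push_cast at h1
  nlinarith [mul_nonneg hs hlog.le]

/-- The pullback of a divisor by an injective map of linear growth, defined outside of a disc. -/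
noncomputable def shiftDivisor (D : Function.locallyFinsupp ℂ ℤ) (σ : ℂ → ℂ) (M K : ℝ)
    (hinj : Set.InjOn σ {y | M < ‖y‖}) (hbd : ∀ y, M < ‖y‖ → ‖σ y‖ ≤ K * ‖y‖) (hK : 0 ≤ K) :
    Function.locallyFinsupp ℂ ℤ where
  toFun y := if M < ‖y‖ then D (σ y) else 0
  supportWithinDomain' := Set.subset_univ _
  supportLocallyFiniteWithinDomain' := by
    intro y₀ _
    refine ⟨Metric.ball 0 (‖y₀‖ + 1), Metric.isOpen_ball.mem_nhds (by simp), ?_⟩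
    refine Set.Finite.of_finite_image (f := σ)
      ((finite_ball_support D (K * (‖y₀‖ + 1))).subset ?_) ?_
    · rintro _ ⟨y, ⟨hy, hy2⟩, rfl⟩
      rw [Function.mem_support] at hy2
      have hy3 : M < ‖y‖ := by
        by_contra h; exact hy2 (if_neg h)
      rw [if_pos hy3] at hy2
      refine ⟨(hbd y hy3).trans ?_, hy2⟩
      have : ‖y‖ < ‖y₀‖ + 1 := by simpa using hy
      gcongr
    · refine hinj.mono ?_
      rintro y ⟨_, hy2⟩
      by_contra h
      exact hy2 (if_neg h)

lemma shiftDivisor_apply (D : Function.locallyFinsupp ℂ ℤ) (σ : ℂ → ℂ) (M K : ℝ)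
    (hinj : Set.InjOn σ {y | M < ‖y‖}) (hbd : ∀ y, M < ‖y‖ → ‖σ y‖ ≤ K * ‖y‖) (hK : 0 ≤ K) (y : ℂ) :
    shiftDivisor D σ M K hinj hbd hK y = if M < ‖y‖ then D (σ y) else 0 := rfl

/-- The weight of `y` at radius `r` is at most that of `σ y` at radius `K r`, and injectivity
ensures that no point of `D` is used twice. -/
lemma logCounting_shiftDivisor_le {D : Function.locallyFinsupp ℂ ℤ} (hD : 0 ≤ D) {σ : ℂ → ℂ}
    {M K : ℝ} (hinj : Set.InjOn σ {y | M < ‖y‖}) (hbd : ∀ y, M < ‖y‖ → ‖σ y‖ ≤ K * ‖y‖)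
    (hM : 0 ≤ M) (hσ : ∀ y, M < ‖y‖ → σ y ≠ 0) (hK : 1 ≤ K) {r : ℝ} (hr : 1 ≤ r) :
    (shiftDivisor D σ M K hinj hbd (zero_le_one.trans hK)).logCounting r ≤
      D.logCounting (K * r) := by
  classical
  set E := shiftDivisor D σ M K hinj hbd (zero_le_one.trans hK) with hE
  have hKr : 1 ≤ K * r := by nlinarith
  have hnn : ∀ z, (0 : ℝ) ≤ D z := fun z => by exact_mod_cast hD z
  set Z := (finite_ball_support E r).toFinset with hZ
  have hmem : ∀ y ∈ Z, M < ‖y‖ := by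
    intro y hy
    simp only [hZ, Set.Finite.mem_toFinset, Set.mem_ofPred_eq] at hy
    by_contra h
    exact hy.2 (if_neg h)
  rw [logCounting_eq_sum_toFinset E (by positivity) le_rfl,
    logCounting_eq_sum D (by positivity)
      ((finite_ball_support D (K * r)).toFinset ∪ Z.image σ) fun z hz hD => by simp [hz, hD]]
  refine le_trans ?_ (Finset.sum_le_sum_of_subset_of_nonneg Finset.subset_union_right
      fun z _ _ => mul_nonneg (hnn z) (countWeight_nonneg hKr z))
  rw [Finset.sum_image fun a ha b hb h => hinj (hmem a ha) (hmem b hb) h]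
  refine Finset.sum_le_sum fun y hy => ?_
  have hy1 := hmem y hy
  rw [hE, shiftDivisor_apply, if_pos hy1]
  refine mul_le_mul_of_nonneg_left ?_ (hnn _)
  refine countWeight_le_countWeight (by positivity) (hσ y hy1) ?_ (hbd y hy1)
  rintro rfl
  rw [norm_zero] at hy1
  linarith

lemma shiftDivisor_nonneg {D : Function.locallyFinsupp ℂ ℤ} (hD : 0 ≤ D) {σ : ℂ → ℂ}
    {M K : ℝ} (hinj : Set.InjOn σ {y | M < ‖y‖}) (hbd : ∀ y, M < ‖y‖ → ‖σ y‖ ≤ K * ‖y‖)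
    (hK : 0 ≤ K) : 0 ≤ shiftDivisor D σ M K hinj hbd hK := by
  intro y
  rw [shiftDivisor_apply]
  split_ifs
  · exact hD _
  · exact le_rfl

/-- Divisors that are comparable outside of a disc have comparable counting functions up to
`O(log r)`. -/
lemma exists_logCounting_le_add {D E : Function.locallyFinsupp ℂ ℤ} {M : ℝ}
    (h : ∀ z, M < ‖z‖ → D z ≤ E z) :
    ∃ C, ∀ᶠ r in atTop, D.logCounting r ≤ E.logCounting r + C * Real.log r := by
  set F := (D - E)⁺ with hF
  have hfin : F.support.Finite := by
    refine (finite_ball_support (D - E) M).subset ?_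
    intro z hz
    rw [Function.mem_support, hF, Function.locallyFinsuppWithin.posPart_apply] at hz
    have h1 : ¬ (D - E) z ≤ 0 := fun h => hz (posPart_eq_zero.2 h)
    refine ⟨?_, fun h => h1 h.le⟩
    by_contra hM
    apply h1
    have := h z (not_le.1 hM)
    simpa using this
  obtain ⟨C, hC⟩ := (Function.locallyFinsuppWithin.logCounting_isBigO_log_of_finite_support
    hfin).bound
  refine ⟨C, ?_⟩
  filter_upwards [hC, eventually_ge_atTop 1] with r hr hr1
  have hle : D ≤ E + F := by
    have := le_posPart (D - E)
    rwa [sub_le_iff_le_add'] at this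
  have h2 := Function.locallyFinsuppWithin.logCounting_le hle hr1
  rw [map_add, Pi.add_apply] at h2
  rw [Real.norm_eq_abs, Real.norm_eq_abs, abs_of_nonneg (Real.log_nonneg hr1)] at hr
  linarith [le_abs_self (F.logCounting r)]

end AskeyWilson

namespace AskeyWilson

open Real Metric

/-! ### Circle averages -/

lemma circleAverage_mono_codiscreteWithin {f g : ℂ → ℝ} {c : ℂ} {R : ℝ} (hR : R ≠ 0)
    (hf : CircleIntegrable f c R) (hg : CircleIntegrable g c R)
    (h : ∀ᶠ x in codiscreteWithin (sphere c |R|), f x ≤ g x) :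
    circleAverage f c R ≤ circleAverage g c R := by
  have he : f =ᶠ[codiscreteWithin (sphere c |R|)] fun x => min (f x) (g x) := by
    filter_upwards [h] with x hx
    exact (min_eq_left hx).symm
  rw [circleAverage_congr_codiscreteWithin he hR]
  exact circleAverage_mono (hf.congr_codiscreteWithin he) hg fun x _ => min_le_right _ _

lemma codiscreteWithin_of_finite {s : Set ℂ} {p : ℂ → Prop} (h : {x | x ∈ s ∧ ¬ p x}.Finite) :
    ∀ᶠ x in codiscreteWithin s, p x := by
  rw [Filter.Eventually, mem_codiscreteWithin]
  intro x _
  rw [disjoint_principal_right]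
  have h1 : {y | y ∈ s ∧ ¬ p y} \ {x} |>.Finite := h.subset Set.sdiff_subset
  have h2 : ({y | y ∈ s ∧ ¬ p y} \ {x})ᶜ ∈ 𝓝 x := h1.isClosed.isOpen_compl.mem_nhds (by simp)
  filter_upwards [nhdsWithin_le_nhds h2, self_mem_nhdsWithin] with y hy hyx hys
  exact hy ⟨hys, hyx⟩

lemma finite_of_codiscreteWithin {s : Set ℂ} (hs : IsCompact s) {p : ℂ → Prop}
    (h : ∀ᶠ x in codiscreteWithin s, p x) : {x | x ∈ s ∧ ¬ p x}.Finite := by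
  refine Set.not_infinite.1 fun hinf => ?_
  obtain ⟨x, hx, hacc⟩ := hinf.exists_accPt_of_subset_isCompact hs fun y hy => hy.1
  rw [Filter.Eventually, mem_codiscreteWithin] at h
  have h1 := h x hx
  rw [accPt_iff_frequently_nhdsNE] at hacc
  rw [disjoint_principal_right] at h1
  exact hacc (by filter_upwards [h1] with y hy hy2 using hy ⟨hy2.1, hy2.2⟩)

lemma circleAverage_log_norm_sub {r : ℝ} (hr : 0 < r) (u : ℂ) :
    circleAverage (fun x => log ‖x - u‖) 0 r = log (max r ‖u‖) := by
  rw [circleAverage_log_norm_sub_const_eq_log_radius_add_posLog hr.ne']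
  rw [zero_sub, norm_neg]
  have hpl : log⁺ (r⁻¹ * ‖u‖) = max 0 (log (r⁻¹ * ‖u‖)) := rfl
  rw [hpl]
  rcases le_or_gt ‖u‖ r with h | h
  · rw [max_eq_left h, max_eq_left, add_zero]
    refine log_nonpos (by positivity) ?_
    rw [inv_mul_le_iff₀ hr]; linarith
  · have hu : 0 < ‖u‖ := hr.trans h
    rw [max_eq_right h.le, max_eq_right, log_mul (by positivity) (by positivity), log_inv]
    · ring
    · refine log_nonneg ?_
      rw [le_inv_mul_iff₀ hr]; linarith

lemma abs_log_eq (t : ℝ) : |log t| = 2 * log⁺ t - log t := by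
  rw [← half_mul_log_add_log_abs]; ring

lemma circleAverage_abs_log_norm_sub_le {r : ℝ} (hr : 1 ≤ r) (u : ℂ) :
    circleAverage (fun x => |log ‖x - u‖|) 0 r ≤ 2 * log (r + ‖u‖ + 1) := by
  have hr0 : 0 < r := by linarith
  have hm : ∀ s : Set ℂ, MeromorphicOn (fun x : ℂ => x - u) s := fun s x _ => by fun_prop
  have h1 : CircleIntegrable (fun x : ℂ => log ‖x - u‖) 0 r := (hm _).circleIntegrable_log_norm
  have h2 : CircleIntegrable (fun x : ℂ => 2 * log (r + ‖u‖ + 1) - log ‖x - u‖) 0 r :=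
    (circleIntegrable_const _ _ _).sub h1
  have h3 : circleAverage (fun x => |log ‖x - u‖|) 0 r ≤
      circleAverage (fun x : ℂ => 2 * log (r + ‖u‖ + 1) - log ‖x - u‖) 0 r := by
    refine circleAverage_mono h1.abs h2 fun x hx => ?_
    rw [abs_log_eq]
    have hx : ‖x‖ = r := by simpa [abs_of_pos hr0] using hx
    have : log⁺ ‖x - u‖ ≤ log (r + ‖u‖ + 1) := by
      refine max_le (log_nonneg (by linarith [norm_nonneg u])) ?_
      rcases eq_or_ne x u with h | h
      · rw [h]; simp only [sub_self, norm_zero, log_zero]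
        exact log_nonneg (by linarith [norm_nonneg u])
      · refine log_le_log (norm_pos_iff.2 (sub_ne_zero.2 h)) ?_
        linarith [norm_sub_le x u]
    linarith
  refine h3.trans ?_
  rw [circleAverage_fun_sub (circleIntegrable_const _ _ _) h1, circleAverage_const,
    circleAverage_log_norm_sub hr0]
  have : 0 ≤ log (max r ‖u‖) := log_nonneg (hr.trans (le_max_left _ _))
  linarith

lemma circleAverage_abs_log_norm_eq {f : ℂ → ℂ} (hf : Meromorphic f) (r : ℝ) :
    circleAverage (fun x => |log ‖f x‖|) 0 r =
      ValueDistribution.proximity f ⊤ r + ValueDistribution.proximity f⁻¹ ⊤ r := by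
  rw [ValueDistribution.proximity_top, ValueDistribution.proximity_top,
    ← circleAverage_fun_add hf.meromorphicOn.circleIntegrable_posLog_norm
      hf.inv.meromorphicOn.circleIntegrable_posLog_norm]
  congr 1
  ext x
  have := posLog_sub_posLog_inv (x := ‖f x‖)
  rw [abs_log_eq, Pi.inv_apply, norm_inv]
  linarith

/-- The proximity contributions of a function and of its inverse are controlled by the
characteristic. -/
lemma exists_circleAverage_abs_log_norm_le {f : ℂ → ℂ} (hf : Meromorphic f) :
    ∃ C, 0 ≤ C ∧ ∀ r, 1 ≤ r → circleAverage (fun x => |log ‖f x‖|) 0 r ≤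
      2 * ValueDistribution.characteristic f ⊤ r + C := by
  refine ⟨max |log ‖f 0‖| |log ‖meromorphicTrailingCoeffAt f 0‖|,
    le_max_of_le_left (abs_nonneg _), fun r hr => ?_⟩
  rw [circleAverage_abs_log_norm_eq hf]
  have h1 := ValueDistribution.characteristic_sub_characteristic_inv_le (R := r) hf
  have h2 := ValueDistribution.logCounting_nonneg (f := f) (e := ⊤) hr
  have h3 := ValueDistribution.logCounting_nonneg (f := f⁻¹) (e := ⊤) hr
  have h4 := neg_le_of_abs_le h1
  have e1 : ValueDistribution.characteristic f ⊤ r =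
    ValueDistribution.proximity f ⊤ r + ValueDistribution.logCounting f ⊤ r := rfl
  have e2 : ValueDistribution.characteristic f⁻¹ ⊤ r =
    ValueDistribution.proximity f⁻¹ ⊤ r + ValueDistribution.logCounting f⁻¹ ⊤ r := rfl
  linarith

/-- The logarithm of the modulus of a zero-free holomorphic function is nearly constant well inside
a disc. -/
lemma abs_log_norm_sub_circleAverage_le {h : ℂ → ℂ} {R : ℝ} (hR : 0 < R)
    (hh : AnalyticOnNhd ℂ h (closedBall 0 R)) (h0 : ∀ x ∈ closedBall 0 R, h x ≠ 0) {w : ℂ}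
    (hw : ‖w‖ ≤ R / 2) :
    |log ‖h w‖ - circleAverage (fun x => log ‖h x‖) 0 R| ≤
      4 * ‖w‖ / R * circleAverage (fun x => |log ‖h x‖|) 0 R := by
  have hwb : w ∈ ball (0 : ℂ) R := by
    rw [mem_ball_zero_iff]; linarith
  have hharm : InnerProductSpace.HarmonicOnNhd (fun x => log ‖h x‖) (closedBall 0 R) :=
    fun x hx => (hh x hx).harmonicAt_log_norm (h0 x hx)
  -- The Poisson representation. Its kernel lies between `(R - |w|) / (R + |w|)` and `(R + |w|) / (R
  -- - |w|)`, hence within `4 |w| / R` of `1` when `|w| ≤ R / 2`.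
  have hP := hharm.circleAverage_re_herglotzRieszKernel_smul hwb
  have hsub : sphere (0 : ℂ) R ⊆ closedBall 0 R := sphere_subset_closedBall
  have hcl : ContinuousOn (fun x => log ‖h x‖) (sphere 0 R) := by
    refine ContinuousOn.log ((hh.continuousOn.mono hsub).norm) fun x hx => ?_
    exact (norm_pos_iff.2 (h0 x (hsub hx))).ne'
  have hck : ContinuousOn (Complex.re ∘ herglotzRieszKernel 0 w) (sphere 0 R) := by
    refine Complex.continuous_re.comp_continuousOn ?_
    unfold herglotzRieszKernel
    refine ContinuousOn.div (by fun_prop) (by fun_prop) fun x hx => ?_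
    rw [sub_zero, sub_zero, sub_ne_zero]
    rintro rfl
    rw [mem_sphere_zero_iff_norm] at hx
    rw [mem_ball_zero_iff] at hwb
    linarith
  have i1 : CircleIntegrable (fun x => log ‖h x‖) 0 R := hcl.circleIntegrable hR.le
  have i2 : CircleIntegrable ((Complex.re ∘ herglotzRieszKernel 0 w) • fun x => log ‖h x‖) 0 R :=
    (hck.smul hcl).circleIntegrable hR.le
  rw [← hP, ← circleAverage_sub i2 i1]
  refine abs_circleAverage_le_circleAverage_abs.trans ?_
  rw [← smul_eq_mul, ← circleAverage_fun_smul]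
  refine circleAverage_mono (i2.sub i1).abs (i1.abs.const_mul _) fun x hx => ?_
  rw [abs_of_pos hR] at hx
  have k1 := re_herglotzRieszKernel_le hx hwb
  have k2 := le_re_herglotzRieszKernel hx hwb
  rw [sub_zero w] at k1 k2
  have e : (Complex.re ∘ herglotzRieszKernel 0 w) x = ((x - 0 + w) / ((x - 0) - w)).re := by
    simp [herglotzRieszKernel]
  change |(Complex.re ∘ herglotzRieszKernel 0 w) x * log ‖h x‖ - log ‖h x‖| ≤
    4 * ‖w‖ / R * |log ‖h x‖|
  rw [e]
  rw [← sub_one_mul, abs_mul]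
  refine mul_le_mul_of_nonneg_right ?_ (abs_nonneg _)
  have hwn := norm_nonneg w
  rw [abs_le]
  constructor
  · have : 1 - 4 * ‖w‖ / R ≤ (R - ‖w‖) / (R + ‖w‖) := by
      rw [le_div_iff₀ (by linarith), sub_mul, div_mul_eq_mul_div]
      have : 4 * ‖w‖ ≤ 4 * ‖w‖ * (R + ‖w‖) / R := by
        rw [le_div_iff₀ hR]; nlinarith
      linarith
    linarith
  · have : (R + ‖w‖) / (R - ‖w‖) ≤ 1 + 4 * ‖w‖ / R := by
      rw [div_le_iff₀ (by linarith), add_mul, div_mul_eq_mul_div]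
      have : 2 * ‖w‖ ≤ 4 * ‖w‖ * (R - ‖w‖) / R := by
        rw [le_div_iff₀ hR]; nlinarith
      linarith
    linarith

/-- The zero-free factor of a meromorphic function is controlled on circles. -/
lemma circleAverage_abs_log_norm_factor_le {f h : ℂ → ℂ} {R : ℝ} (hR : 1 ≤ R) {Z : Finset ℂ}
    {m : ℂ → ℤ} (hf : Meromorphic f) (hh : MeromorphicOn h (sphere 0 R))
    (heq : ∀ᶠ x in codiscreteWithin (sphere (0 : ℂ) R),
      log ‖f x‖ = ∑ u ∈ Z, (m u : ℝ) * log ‖x - u‖ + log ‖h x‖) :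
    circleAverage (fun x => |log ‖h x‖|) 0 R ≤ circleAverage (fun x => |log ‖f x‖|) 0 R +
      ∑ u ∈ Z, |(m u : ℝ)| * (2 * log (R + ‖u‖ + 1)) := by
  have hR0 : 0 < R := by linarith
  have habs : |R| = R := abs_of_pos hR0
  have i1 : CircleIntegrable (fun x => log ‖h x‖) 0 R :=
    MeromorphicOn.circleIntegrable_log_norm (by rwa [habs])
  have i2 : CircleIntegrable (fun x => log ‖f x‖) 0 R :=
    hf.meromorphicOn.circleIntegrable_log_norm
  have i3 : ∀ u ∈ Z, CircleIntegrable (fun x => |(m u : ℝ)| * |log ‖x - u‖|) 0 R := fun u _ =>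
    (circleIntegrable_log_norm_sub_const (c := 0) (a := u) R).abs.const_mul _
  have i4 : CircleIntegrable (fun x => ∑ u ∈ Z, |(m u : ℝ)| * |log ‖x - u‖|) 0 R :=
    CircleIntegrable.fun_sum _ i3
  have i5 : CircleIntegrable (fun x => |log ‖f x‖|) 0 R := i2.abs
  calc circleAverage (fun x => |log ‖h x‖|) 0 R
      ≤ circleAverage (fun x => |log ‖f x‖| + ∑ u ∈ Z, |(m u : ℝ)| * |log ‖x - u‖|) 0 R := by
        refine circleAverage_mono_codiscreteWithin hR0.ne' i1.abs (i5.add i4) ?_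
        rw [habs]
        filter_upwards [heq] with x hx
        have e : log ‖h x‖ = log ‖f x‖ - ∑ u ∈ Z, (m u : ℝ) * log ‖x - u‖ := by rw [hx]; ring
        rw [e]
        refine (abs_sub _ _).trans (add_le_add_right ?_ _)
        refine (Finset.abs_sum_le_sum_abs _ _).trans (le_of_eq ?_)
        exact Finset.sum_congr rfl fun u _ => abs_mul _ _
    _ = circleAverage (fun x => |log ‖f x‖|) 0 R +
        ∑ u ∈ Z, |(m u : ℝ)| * circleAverage (fun x => |log ‖x - u‖|) 0 R := by
        rw [circleAverage_fun_add i5 i4, circleAverage_fun_sum i3]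
        congr 1
        refine Finset.sum_congr rfl fun u _ => ?_
        simp_rw [← smul_eq_mul]
        rw [circleAverage_fun_smul]
    _ ≤ _ := by
        gcongr with u _
        exact circleAverage_abs_log_norm_sub_le hR u

/-! ### Differences of logarithms -/

/-- A map of linear growth, holomorphic and injective near infinity, for which the means of
`log ‖σ x - u‖` over circles are bounded below as for the identity. -/
structure IsShift (σ : ℂ → ℂ) (M K C : ℝ) : Prop where
  one_le_radius : 1 ≤ M
  one_le_factor : 1 ≤ K
  analyticAt : ∀ x, M < ‖x‖ → AnalyticAt ℂ σ x
  injOn : Set.InjOn σ {x | M < ‖x‖}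
  norm_le : ∀ x, M < ‖x‖ → ‖σ x‖ ≤ K * ‖x‖
  le_circleAverage : ∀ u : ℂ, ∀ r, M < r →
    log (max r ‖u‖) - C ≤ circleAverage (fun x => log ‖σ x - u‖) 0 r

/-- Both `log a` and `log b` are at most each of `log (a + d)` and `log (b + d)`. The bound
separates `a` from `b`, so its mean is controlled once the means of `log a` and `log b` are bounded
below. -/
lemma abs_log_sub_log_le {a b d : ℝ} (ha : 0 < a) (hb : 0 < b) (hab : |a - b| ≤ d) :
    |log a - log b| ≤ (log (a + d) - log a) + (log (b + d) - log b) := by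
  have hd : 0 ≤ d := (abs_nonneg _).trans hab
  have h := abs_le.1 hab
  have h1 : log a ≤ log (b + d) := log_le_log ha (by linarith)
  have h2 : log b ≤ log (a + d) := log_le_log hb (by linarith)
  have h3 : log a ≤ log (a + d) := log_le_log ha (by linarith)
  have h4 : log b ≤ log (b + d) := log_le_log hb (by linarith)
  rw [abs_le]
  constructor <;> linarith

/-- The number of zeros and poles in a disc, bounded by the characteristic. -/
lemma exists_sum_abs_divisor_le {f : ℂ → ℂ} (hf : Meromorphic f) :
    ∃ C, 0 ≤ C ∧ ∀ r, 1 < r →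
      ∑ u ∈ (finite_ball_support (MeromorphicOn.divisor f Set.univ) (r ^ 2)).toFinset,
        |(MeromorphicOn.divisor f Set.univ u : ℝ)| ≤
      (2 * ValueDistribution.characteristic f ⊤ (r ^ 4) + C) / (2 * log r) := by
  set D := MeromorphicOn.divisor f Set.univ with hD
  refine ⟨max |log ‖f 0‖| |log ‖meromorphicTrailingCoeffAt f 0‖|,
    le_max_of_le_left (abs_nonneg _), fun r hr => ?_⟩
  have hlog := log_pos hr
  have hr2 : 1 ≤ r ^ 2 := by nlinarith
  have hr4 : 1 ≤ r ^ 4 := by nlinarith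
  set E := D⁺ + D⁻ with hE
  have hE0 : 0 ≤ E := add_nonneg (posPart_nonneg _) (negPart_nonneg _)
  have hEabs : ∀ u, (E u : ℝ) = |(D u : ℝ)| := by
    intro u
    have : E u = |D u| := posPart_add_negPart (D u)
    rw [this]; push_cast; rfl
  have h := sum_mul_log_le hE0 hr2
  have hZ : (finite_ball_support E (r ^ 2)).toFinset = (finite_ball_support D (r ^ 2)).toFinset := by
    ext u
    simp only [Set.Finite.mem_toFinset, Set.mem_ofPred_eq, ne_eq]
    have : E u = 0 ↔ D u = 0 := by
      have : E u = |D u| := posPart_add_negPart (D u)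
      rw [this, abs_eq_zero]
    rw [this]
  rw [hZ, Finset.sum_congr rfl fun u _ => hEabs u, hE, map_add, Pi.add_apply, hD,
    ← ValueDistribution.logCounting_zero, ← ValueDistribution.logCounting_top,
    ← ValueDistribution.logCounting_inv, log_pow, ← hD, show (r ^ 2) ^ 2 = r ^ 4 by ring] at h
  push_cast at h
  have h1 := ValueDistribution.characteristic_sub_characteristic_inv_le (R := r ^ 4) hf
  have h4 := neg_le_of_abs_le h1
  have p1 := ValueDistribution.proximity_nonneg (f := f) (a := ⊤) (r ^ 4)
  have p2 := ValueDistribution.proximity_nonneg (f := f⁻¹) (a := ⊤) (r ^ 4)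
  have e1 : ValueDistribution.characteristic f ⊤ (r ^ 4) =
    ValueDistribution.proximity f ⊤ (r ^ 4) + ValueDistribution.logCounting f ⊤ (r ^ 4) := rfl
  have e2 : ValueDistribution.characteristic f⁻¹ ⊤ (r ^ 4) =
    ValueDistribution.proximity f⁻¹ ⊤ (r ^ 4) + ValueDistribution.logCounting f⁻¹ ⊤ (r ^ 4) := rfl
  rw [le_div_iff₀ (by positivity)]
  simp only [Pi.zero_apply] at p1 p2
  linarith

/-- A single zero or pole `u` costs a constant independent of `u` and `r`: the four means all equal
`log (max r ‖u‖)` up to one-sided constants, and these main terms cancel. -/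
lemma IsShift.circleAverage_le {σ : ℂ → ℂ} {M K C : ℝ} (hσ : IsShift σ M K C) (u : ℂ) {r : ℝ}
    (hr : M < r) :
    CircleIntegrable (fun x => (log (‖x - u‖ + (K + 1) * r) - log ‖x - u‖) +
        (log (‖σ x - u‖ + (K + 1) * r) - log ‖σ x - u‖)) 0 r ∧
      circleAverage (fun x => (log (‖x - u‖ + (K + 1) * r) - log ‖x - u‖) +
        (log (‖σ x - u‖ + (K + 1) * r) - log ‖σ x - u‖)) 0 r ≤
      2 * log (2 * K + 3) + C := by
  have hM := hσ.one_le_radius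
  have hK := hσ.one_le_factor
  have hr0 : 0 < r := by linarith
  have hd : 0 < (K + 1) * r := by positivity
  have habs : |r| = r := abs_of_pos hr0
  have hsph : ∀ x ∈ sphere (0 : ℂ) r, M < ‖x‖ := fun x hx => by
    rw [mem_sphere_zero_iff_norm] at hx; linarith
  have hcont : ContinuousOn σ (sphere 0 r) := fun x hx =>
    (hσ.analyticAt x (hsph x hx)).continuousAt.continuousWithinAt
  have i1 : CircleIntegrable (fun x : ℂ => log (‖x - u‖ + (K + 1) * r)) 0 r := by
    refine ContinuousOn.circleIntegrable hr0.le (ContinuousOn.log (by fun_prop) fun x _ => ?_)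
    positivity
  have i2 : CircleIntegrable (fun x : ℂ => log ‖x - u‖) 0 r :=
    circleIntegrable_log_norm_sub_const r
  have i3 : CircleIntegrable (fun x : ℂ => log (‖σ x - u‖ + (K + 1) * r)) 0 r := by
    refine ContinuousOn.circleIntegrable hr0.le (ContinuousOn.log (by fun_prop) fun x _ => ?_)
    positivity
  have i4 : CircleIntegrable (fun x : ℂ => log ‖σ x - u‖) 0 r := by
    refine MeromorphicOn.circleIntegrable_log_norm fun x hx => ?_
    rw [habs] at hx
    exact ((hσ.analyticAt x (hsph x hx)).sub analyticAt_const).meromorphicAt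
  have i5 : CircleIntegrable (fun x : ℂ => log (‖x - u‖ + (K + 1) * r) - log ‖x - u‖) 0 r :=
    i1.sub i2
  have i6 : CircleIntegrable (fun x : ℂ => log (‖σ x - u‖ + (K + 1) * r) - log ‖σ x - u‖) 0 r :=
    i3.sub i4
  refine ⟨i5.add i6, ?_⟩
  rw [circleAverage_fun_add i5 i6, circleAverage_fun_sub i1 i2,
    circleAverage_fun_sub i3 i4, circleAverage_log_norm_sub hr0]
  have h4 := hσ.le_circleAverage u r hr
  set m := max r ‖u‖ with hm
  have hm1 : r ≤ m := le_max_left _ _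
  have hm2 : ‖u‖ ≤ m := le_max_right _ _
  have hm0 : 0 < m := by linarith
  have bound : ∀ t : ℝ, 0 < t → t ≤ (2 * K + 3) * m → log t ≤ log (2 * K + 3) + log m := by
    intro t ht htm
    rw [← log_mul (by positivity) hm0.ne']
    exact log_le_log ht htm
  have b1 : circleAverage (fun x : ℂ => log (‖x - u‖ + (K + 1) * r)) 0 r ≤
      log (2 * K + 3) + log m := by
    refine circleAverage_mono_on_of_le_circle i1 fun x hx => ?_
    rw [habs, mem_sphere_zero_iff_norm] at hx
    refine bound _ (by positivity) ?_
    have := norm_sub_le x u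
    nlinarith
  have b2 : circleAverage (fun x : ℂ => log (‖σ x - u‖ + (K + 1) * r)) 0 r ≤
      log (2 * K + 3) + log m := by
    refine circleAverage_mono_on_of_le_circle i3 fun x hx => ?_
    rw [habs] at hx
    have h5 := hσ.norm_le x (hsph x hx)
    rw [mem_sphere_zero_iff_norm] at hx
    refine bound _ (by positivity) ?_
    have := norm_sub_le (σ x) u
    rw [hx] at h5
    nlinarith
  linarith

/-- The analogue of the lemma on the logarithmic derivative for the quotients `f (σ x) / f x`. -/
theorem IsShift.exists_circleAverage_posLog_le {σ : ℂ → ℂ} {M K C : ℝ} (hσ : IsShift σ M K C)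
    {f : ℂ → ℂ} (hf : Meromorphic f) (hne : ∀ z, meromorphicOrderAt f z ≠ ⊤) :
    ∃ A, 0 ≤ A ∧ ∀ᶠ r in atTop, circleAverage (fun x => log⁺ ‖f (σ x) / f x‖) 0 r ≤
      A * ((1 + ValueDistribution.characteristic f ⊤ (r ^ 4)) / log r) := by
  obtain ⟨C₁, hC₁, hcount⟩ := exists_sum_abs_divisor_le hf
  obtain ⟨C₂, hC₂, habsavg⟩ := exists_circleAverage_abs_log_norm_le hf
  have hM := hσ.one_le_radius
  have hK := hσ.one_le_factor
  set B := max (2 * log (2 * K + 3) + C) 0 with hB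
  have hB0 : 0 ≤ B := le_max_right _ _
  refine ⟨(B + 64 * K) * (1 + C₁) + 8 * K * (2 + C₂), by positivity, ?_⟩
  filter_upwards [eventually_gt_atTop M, eventually_ge_atTop (2 * K), eventually_ge_atTop 4]
    with r hrM hrK hr4
  have hr1 : 1 < r := by linarith
  have hr0 : 0 < r := by linarith
  have hlog : 0 < log r := log_pos hr1
  have habs : |r| = r := abs_of_pos hr0
  -- On this larger disc the oscillation of the zero-free factor carries a factor of order `r / R =
  -- 1 / r`, while the zeros and poles in it are still counted by `T(r⁴) / log r`.
  set R := r ^ 2 with hRdef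
  have hR1 : 1 ≤ R := by nlinarith
  have hR0 : 0 < R := by linarith
  have hKr : K * r ≤ R / 2 := by nlinarith
  have hrR2 : r ≤ R / 2 := by nlinarith
  set D := MeromorphicOn.divisor f Set.univ with hD
  set Z := (finite_ball_support D R).toFinset with hZ
  have hfR : MeromorphicOn f (closedBall 0 R) := hf.meromorphicOn
  have hdiv : ∀ u ∈ closedBall (0 : ℂ) R, MeromorphicOn.divisor f (closedBall 0 R) u = D u := by
    intro u hu
    rw [MeromorphicOn.divisor_apply hfR hu, hD,
      MeromorphicOn.divisor_apply hf.meromorphicOn (Set.mem_univ u)]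
  obtain ⟨h, hh, hh0, hfh⟩ := hfR.extract_zeros_poles (fun u => hne u)
    ((MeromorphicOn.divisor f (closedBall 0 R)).finiteSupport (isCompact_closedBall 0 R))
  have hlogeq := MeromorphicOn.extract_zeros_poles_log hh0 hfh
  have hsum : ∀ x, (∑ᶠ u, ((MeromorphicOn.divisor f (closedBall 0 R) u : ℝ) * log ‖· - u‖)
      + (log ‖h ·‖)) x = ∑ u ∈ Z, (D u : ℝ) * log ‖x - u‖ + log ‖h x‖ := by
    intro x
    rw [Pi.add_apply]
    congr 1
    rw [finsum_eq_sum_of_support_subset (s := Z), Finset.sum_apply]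
    · refine Finset.sum_congr rfl fun u hu => ?_
      have hu2 : u ∈ closedBall (0 : ℂ) R := by
        simp only [hZ, Set.Finite.mem_toFinset, Set.mem_ofPred_eq] at hu
        simpa using hu.1
      rw [← hdiv u hu2]
    · intro u hu
      rw [Function.mem_support] at hu
      have h1 : MeromorphicOn.divisor f (closedBall 0 R) u ≠ 0 := by
        intro h'; apply hu; ext y; simp [h']
      have h2 : u ∈ closedBall (0 : ℂ) R :=
        (MeromorphicOn.divisor f (closedBall 0 R)).supportWithinDomain h1
      rw [hdiv u h2] at h1
      simp only [hZ, Set.Finite.coe_toFinset, Set.mem_ofPred_eq]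
      exact ⟨by simpa using h2, h1⟩
  have hlogeq2 : ∀ᶠ x in codiscreteWithin (closedBall (0 : ℂ) R),
      log ‖f x‖ = ∑ u ∈ Z, (D u : ℝ) * log ‖x - u‖ + log ‖h x‖ := by
    filter_upwards [hlogeq] with x hx
    rw [← hsum x, ← hx]
  have hbad := finite_of_codiscreteWithin (isCompact_closedBall (0 : ℂ) R) hlogeq2
  -- These are the zeros and poles together with the points where the value of `f` does not obey the
  -- factorisation. By injectivity of `σ`, only finitely many `x` on the circle meet this set or are
  -- mapped into it, and the mean does not see them.
  set bad : Set ℂ := {x | x ∈ closedBall (0 : ℂ) R ∧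
    ¬ (log ‖f x‖ = ∑ u ∈ Z, (D u : ℝ) * log ‖x - u‖ + log ‖h x‖)} ∪ Z with hbaddef
  have hbadfin : bad.Finite := hbad.union Z.finite_toSet
  have hsph : ∀ x ∈ sphere (0 : ℂ) r, M < ‖x‖ := fun x hx => by
    rw [mem_sphere_zero_iff_norm] at hx; linarith
  have hgood : ∀ᶠ x in codiscreteWithin (sphere (0 : ℂ) r), x ∉ bad ∧ σ x ∉ bad := by
    refine codiscreteWithin_of_finite ?_
    have hpre : {x | x ∈ sphere (0 : ℂ) r ∧ σ x ∈ bad}.Finite := by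
      refine Set.Finite.of_finite_image (f := σ) (hbadfin.subset ?_)
        (hσ.injOn.mono fun x hx => hsph x hx.1)
      rintro _ ⟨x, hx, rfl⟩
      exact hx.2
    refine (hbadfin.union hpre).subset ?_
    rintro x ⟨hx, hx2⟩
    by_cases hxb : x ∈ bad
    · exact Or.inl hxb
    · exact Or.inr ⟨hx, by by_contra h'; exact hx2 ⟨hxb, h'⟩⟩
  have hmem : ∀ x ∈ sphere (0 : ℂ) r, ‖x‖ ≤ R / 2 ∧ ‖σ x‖ ≤ R / 2 ∧ ‖x‖ = r ∧ ‖σ x‖ ≤ K * r := by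
    intro x hx
    have h1 := hσ.norm_le x (hsph x hx)
    rw [mem_sphere_zero_iff_norm] at hx
    rw [hx] at h1
    exact ⟨by rw [hx]; exact hrR2, h1.trans hKr, hx, h1⟩
  set I := circleAverage (fun x => |log ‖h x‖|) 0 R with hI
  have hI0 : 0 ≤ I := circleAverage_nonneg_of_nonneg fun _ _ => abs_nonneg _
  set N := ∑ u ∈ Z, |(D u : ℝ)| with hN
  have hN0 : 0 ≤ N := Finset.sum_nonneg fun _ _ => abs_nonneg _
  set W : ℂ → ℂ → ℝ := fun u x => (log (‖x - u‖ + (K + 1) * r) - log ‖x - u‖) +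
        (log (‖σ x - u‖ + (K + 1) * r) - log ‖σ x - u‖) with hW
  have hpt : ∀ᶠ x in codiscreteWithin (sphere (0 : ℂ) r), log⁺ ‖f (σ x) / f x‖ ≤
      ∑ u ∈ Z, |(D u : ℝ)| * W u x + 8 * K / r * I := by
    filter_upwards [hgood, self_mem_codiscreteWithin _] with x hx hxs
    obtain ⟨m1, m2, m3, m4⟩ := hmem x hxs
    have hx1 : x ∈ closedBall (0 : ℂ) R := by
      rw [mem_closedBall_zero_iff]; linarith
    have hx2 : σ x ∈ closedBall (0 : ℂ) R := by
      rw [mem_closedBall_zero_iff]; linarith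
    have e1 : log ‖f x‖ = ∑ u ∈ Z, (D u : ℝ) * log ‖x - u‖ + log ‖h x‖ := by
      by_contra h'; exact hx.1 (Or.inl ⟨hx1, h'⟩)
    have e2 : log ‖f (σ x)‖ = ∑ u ∈ Z, (D u : ℝ) * log ‖σ x - u‖ + log ‖h (σ x)‖ := by
      by_contra h'; exact hx.2 (Or.inl ⟨hx2, h'⟩)
    have p1 := abs_log_norm_sub_circleAverage_le hR0 hh (fun y hy => hh0 ⟨y, hy⟩) m1
    have p2 := abs_log_norm_sub_circleAverage_le hR0 hh (fun y hy => hh0 ⟨y, hy⟩) m2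
    have p3 : |log ‖h (σ x)‖ - log ‖h x‖| ≤ 8 * K / r * I := by
      have q1 : 4 * ‖x‖ / R * I ≤ 4 * K / r * I := by
        refine mul_le_mul_of_nonneg_right ?_ hI0
        rw [m3, div_le_div_iff₀ hR0 hr0, hRdef]; nlinarith
      have q2 : 4 * ‖σ x‖ / R * I ≤ 4 * K / r * I := by
        refine mul_le_mul_of_nonneg_right ?_ hI0
        rw [div_le_div_iff₀ hR0 hr0, hRdef]; nlinarith
      have q3 : 8 * K / r * I = 4 * K / r * I + 4 * K / r * I := by ring
      have q4 := abs_sub_le (log ‖h (σ x)‖) (circleAverage (fun x => log ‖h x‖) 0 R) (log ‖h x‖)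
      rw [abs_sub_comm (circleAverage (fun x => log ‖h x‖) 0 R) (log ‖h x‖)] at q4
      linarith
    have p4 : log⁺ ‖f (σ x) / f x‖ ≤ |log ‖f (σ x)‖ - log ‖f x‖| := by
      by_cases z1 : f (σ x) = 0
      · simp [z1]
      by_cases z2 : f x = 0
      · simp [z2]
      rw [norm_div, ← log_div (norm_ne_zero_iff.2 z1) (norm_ne_zero_iff.2 z2)]
      exact max_le (abs_nonneg _) (le_abs_self _)
    refine p4.trans ?_
    have e3 : log ‖f (σ x)‖ - log ‖f x‖ = ∑ u ∈ Z, (D u : ℝ) * (log ‖σ x - u‖ - log ‖x - u‖)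
        + (log ‖h (σ x)‖ - log ‖h x‖) := by
      rw [e1, e2]; simp only [mul_sub, Finset.sum_sub_distrib]; ring
    rw [e3]
    refine (abs_add_le _ _).trans (add_le_add ?_ p3)
    refine (Finset.abs_sum_le_sum_abs _ _).trans (Finset.sum_le_sum fun u hu => ?_)
    rw [abs_mul]
    refine mul_le_mul_of_nonneg_left ?_ (abs_nonneg _)
    have n1 : 0 < ‖x - u‖ := norm_pos_iff.2 (sub_ne_zero.2 fun h' => hx.1 (Or.inr (h' ▸ hu)))
    have n2 : 0 < ‖σ x - u‖ := norm_pos_iff.2 (sub_ne_zero.2 fun h' => hx.2 (Or.inr (h' ▸ hu)))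
    rw [abs_sub_comm]
    refine abs_log_sub_log_le n1 n2 ((abs_norm_sub_norm_le _ _).trans ?_)
    have : x - u - (σ x - u) = x - σ x := by ring
    rw [this]
    refine (norm_sub_le _ _).trans ?_
    linarith
  have iL : CircleIntegrable (fun x => log⁺ ‖f (σ x) / f x‖) 0 r := by
    have : MeromorphicOn (fun x => f (σ x) / f x) (sphere 0 |r|) := by
      intro x hx
      rw [habs] at hx
      exact ((hf _).comp_analyticAt (hσ.analyticAt x (hsph x hx))).div (hf x)
    exact this.circleIntegrable_posLog_norm
  have iW : ∀ u ∈ Z, CircleIntegrable (fun x => |(D u : ℝ)| * W u x) 0 r := fun u _ =>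
    (hσ.circleAverage_le u hrM).1.const_mul _
  have iW2 : CircleIntegrable (fun x => ∑ u ∈ Z, |(D u : ℝ)| * W u x) 0 r :=
    CircleIntegrable.fun_sum _ iW
  have hmain : circleAverage (fun x => log⁺ ‖f (σ x) / f x‖) 0 r ≤ N * B + 8 * K / r * I := by
    refine (circleAverage_mono_codiscreteWithin hr0.ne' iL
      (iW2.add (circleIntegrable_const (8 * K / r * I) 0 r)) (by rwa [habs])).trans ?_
    rw [circleAverage_add iW2 (circleIntegrable_const _ _ _), circleAverage_const,
      circleAverage_fun_sum iW, hN, Finset.sum_mul]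
    gcongr with u _
    simp_rw [← smul_eq_mul]
    rw [circleAverage_fun_smul]
    simp only [smul_eq_mul]
    gcongr
    exact (hσ.circleAverage_le u hrM).2.trans (le_max_left _ _)
  have hIbound : I ≤ 2 * ValueDistribution.characteristic f ⊤ R + C₂ + N * (8 * r) := by
    have hsub : sphere (0 : ℂ) R ⊆ closedBall 0 R := sphere_subset_closedBall
    have h1 := circleAverage_abs_log_norm_factor_le hR1 hf
      (fun x hx => (hh x (hsub hx)).meromorphicAt) (hlogeq2.filter_mono (codiscreteWithin_mono hsub))
    refine h1.trans (add_le_add (habsavg R hR1) ?_)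
    rw [hN, Finset.sum_mul]
    refine Finset.sum_le_sum fun u hu => mul_le_mul_of_nonneg_left ?_ (abs_nonneg _)
    have hu2 : ‖u‖ ≤ R := by
      simp only [hZ, Set.Finite.mem_toFinset, Set.mem_ofPred_eq] at hu
      exact hu.1
    -- A bound linear in `r` suffices, because it is multiplied by `8 * K / r` afterwards.
    have : log (R + ‖u‖ + 1) ≤ log ((2 * r) ^ 2) := by
      refine log_le_log (by positivity) ?_
      nlinarith
    rw [log_pow] at this
    have h3 := log_le_sub_one_of_pos (show 0 < 2 * r by positivity)
    push_cast at this
    linarith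
  have hN2 : N ≤ (2 * ValueDistribution.characteristic f ⊤ (r ^ 4) + C₁) / (2 * log r) :=
    hcount r hr1
  set T := ValueDistribution.characteristic f ⊤ (r ^ 4) with hT
  have hTR : ValueDistribution.characteristic f ⊤ R ≤ T :=
    ValueDistribution.characteristic_monotoneOn hf (Set.mem_Ioi.2 hR0)
      (Set.mem_Ioi.2 (by positivity)) (by rw [hRdef]; nlinarith)
  have hT0 : 0 ≤ T := ValueDistribution.characteristic_nonneg (by nlinarith)
  have hlogr : log r ≤ r := (log_le_sub_one_of_pos hr0).trans (by linarith)
  set Q := (1 + T) / log r with hQ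
  have hQ0 : 0 ≤ Q := by positivity
  have hNQ : N ≤ (1 + C₁) * Q := by
    refine hN2.trans ?_
    rw [hQ, ← mul_div_assoc, div_le_div_iff₀ (by positivity) hlog]
    have : 2 * T + C₁ ≤ (1 + C₁) * (1 + T) * 2 := by nlinarith
    nlinarith
  have hr_inv : (2 * T + C₂) / r ≤ (2 + C₂) * Q := by
    rw [hQ, ← mul_div_assoc]
    have : 2 * T + C₂ ≤ (2 + C₂) * (1 + T) := by nlinarith
    gcongr
  have h8 : 8 * K / r * I ≤ 8 * K * ((2 + C₂) * Q) + 64 * K * N := by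
    have : I ≤ 2 * T + C₂ + N * (8 * r) := by linarith
    calc 8 * K / r * I ≤ 8 * K / r * (2 * T + C₂ + N * (8 * r)) := by gcongr
      _ = 8 * K * ((2 * T + C₂) / r) + 64 * K * N := by field_simp; ring
      _ ≤ _ := by gcongr
  calc circleAverage (fun x => log⁺ ‖f (σ x) / f x‖) 0 r ≤ N * B + 8 * K / r * I := hmain
    _ ≤ N * B + (8 * K * ((2 + C₂) * Q) + 64 * K * N) := by gcongr
    _ = (B + 64 * K) * N + 8 * K * (2 + C₂) * Q := by ring
    _ ≤ (B + 64 * K) * ((1 + C₁) * Q) + 8 * K * (2 + C₂) * Q := by gcongr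
    _ = _ := by ring

/-- By `hmul` and Jensen's formula, the means of `log |σ x - u|` and `log |τ x - u|` add up to `log
(max r |σ u|) + log (max r |τ u|)`. This is at least `2 log (max r |u|) - log 2`, since `|σ u| |τ
u|` is nearly `|u|²` or larger. Subtracting the trivial upper bound for the mean belonging to `τ`
leaves the claim. -/
lemma le_circleAverage_log_norm_sub {σ τ : ℂ → ℂ} {M K E : ℝ} (hM : 1 ≤ M) (hK : 1 ≤ K)
    (hE : E ≤ M ^ 2) (hmul : ∀ x u, (σ x - u) * (τ x - u) = (x - σ u) * (x - τ u))
    (hprod : ∀ u, ‖u‖ ^ 2 - E ≤ ‖σ u‖ * ‖τ u‖) (hσ : ∀ x, M < ‖x‖ → AnalyticAt ℂ σ x)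
    (hτ : ∀ x, M < ‖x‖ → AnalyticAt ℂ τ x) (hτK : ∀ x, M < ‖x‖ → ‖τ x‖ ≤ K * ‖x‖)
    (u : ℂ) {r : ℝ} (hr : M < r) :
    log (max r ‖u‖) - log (2 * (K + 1)) ≤ circleAverage (fun x => log ‖σ x - u‖) 0 r := by
  have hr0 : 0 < r := by linarith
  have habs : |r| = r := abs_of_pos hr0
  have hsph : ∀ x ∈ sphere (0 : ℂ) r, M < ‖x‖ := fun x hx => by
    rw [mem_sphere_zero_iff_norm] at hx; linarith
  have i1 : CircleIntegrable (fun x : ℂ => log ‖σ x - u‖) 0 r := by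
    refine MeromorphicOn.circleIntegrable_log_norm fun x hx => ?_
    rw [habs] at hx
    exact ((hσ x (hsph x hx)).sub analyticAt_const).meromorphicAt
  have i2 : CircleIntegrable (fun x : ℂ => log ‖τ x - u‖) 0 r := by
    refine MeromorphicOn.circleIntegrable_log_norm fun x hx => ?_
    rw [habs] at hx
    exact ((hτ x (hsph x hx)).sub analyticAt_const).meromorphicAt
  have i3 : CircleIntegrable (fun x : ℂ => log ‖x - σ u‖) 0 r :=
    circleIntegrable_log_norm_sub_const r
  have i4 : CircleIntegrable (fun x : ℂ => log ‖x - τ u‖) 0 r :=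
    circleIntegrable_log_norm_sub_const r
  have heq : circleAverage (fun x => log ‖σ x - u‖ + log ‖τ x - u‖) 0 r =
      circleAverage (fun x => log ‖x - σ u‖ + log ‖x - τ u‖) 0 r := by
    refine circleAverage_congr_codiscreteWithin ?_ hr0.ne'
    have hfin : ({σ u, τ u} : Set ℂ).Finite := by simp
    have : ∀ᶠ x in codiscreteWithin (sphere (0 : ℂ) |r|), x ∉ ({σ u, τ u} : Set ℂ) :=
      codiscreteWithin_of_finite (hfin.subset fun x hx => not_not.1 hx.2)
    filter_upwards [this] with x hx
    simp only [Set.mem_insert_iff, Set.mem_singleton_iff, not_or] at hx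
    have n1 : x - σ u ≠ 0 := sub_ne_zero.2 hx.1
    have n2 : x - τ u ≠ 0 := sub_ne_zero.2 hx.2
    have n3 : (σ x - u) * (τ x - u) ≠ 0 := by rw [hmul]; exact mul_ne_zero n1 n2
    rw [← log_mul (norm_ne_zero_iff.2 (left_ne_zero_of_mul n3))
      (norm_ne_zero_iff.2 (right_ne_zero_of_mul n3)), ← norm_mul, hmul, norm_mul,
      log_mul (norm_ne_zero_iff.2 n1) (norm_ne_zero_iff.2 n2)]
  rw [circleAverage_fun_add i1 i2, circleAverage_fun_add i3 i4, circleAverage_log_norm_sub hr0,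
    circleAverage_log_norm_sub hr0] at heq
  set m := max r ‖u‖ with hm
  have hm1 : r ≤ m := le_max_left _ _
  have hm2 : ‖u‖ ≤ m := le_max_right _ _
  have hm0 : 0 < m := by linarith
  have hτb : circleAverage (fun x => log ‖τ x - u‖) 0 r ≤ log ((K + 1) * m) := by
    refine circleAverage_mono_on_of_le_circle i2 fun x hx => ?_
    rw [habs] at hx
    have h5 := hτK x (hsph x hx)
    rw [mem_sphere_zero_iff_norm] at hx
    rw [hx] at h5
    have hle : ‖τ x - u‖ ≤ (K + 1) * m := by
      have := norm_sub_le (τ x) u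
      nlinarith
    rcases eq_or_ne (τ x - u) 0 with h | h
    · rw [h, norm_zero, log_zero]
      refine log_nonneg ?_
      nlinarith
    · exact log_le_log (norm_pos_iff.2 h) hle
  -- If `|u|² ≤ 2 r²`, the radii alone suffice. Otherwise `E ≤ M² < r² < |u|² / 2`, and `hprod`
  -- gives the bound.
  have hb : m ^ 2 / 2 ≤ max r ‖σ u‖ * max r ‖τ u‖ := by
    have h1 : r * r ≤ max r ‖σ u‖ * max r ‖τ u‖ :=
      mul_le_mul (le_max_left _ _) (le_max_left _ _) hr0.le (hr0.le.trans (le_max_left _ _))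
    have h2 : ‖σ u‖ * ‖τ u‖ ≤ max r ‖σ u‖ * max r ‖τ u‖ :=
      mul_le_mul (le_max_right _ _) (le_max_right _ _) (norm_nonneg _)
        (hr0.le.trans (le_max_left _ _))
    rcases le_or_gt (‖u‖ ^ 2) (2 * r ^ 2) with h | h
    · have : m ^ 2 ≤ 2 * r ^ 2 := by
        rcases max_choice r ‖u‖ with h' | h' <;> rw [hm, h'] <;> nlinarith
      nlinarith
    · have h3 : r ≤ ‖u‖ := by nlinarith [norm_nonneg u]
      have h4 := hprod u
      rw [hm, max_eq_right h3]
      nlinarith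
  have hlog : log (m ^ 2 / 2) ≤ log (max r ‖σ u‖) + log (max r ‖τ u‖) := by
    have p1 : 0 < max r ‖σ u‖ := hr0.trans_le (le_max_left _ _)
    have p2 : 0 < max r ‖τ u‖ := hr0.trans_le (le_max_left _ _)
    rw [← log_mul p1.ne' p2.ne']
    exact log_le_log (by positivity) hb
  rw [log_div (by positivity) (by norm_num), log_pow] at hlog
  rw [log_mul (by positivity) hm0.ne'] at hτb
  rw [log_mul (by norm_num) (by positivity)]
  push_cast at hlog
  linarith

lemma norm_sq_sub_le_norm_hat_mul {s : ℂ} (hs : s ≠ 0) (u : ℂ) :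
    ‖u‖ ^ 2 - ‖(s - s⁻¹) ^ 2 / 4‖ ≤ ‖hat s u‖ * ‖check s u‖ := by
  rw [← norm_mul, hat_mul_check hs, ← norm_pow]
  exact norm_sub_le_norm_add _ _

/-- The Askey-Wilson shifts are shifts in the sense of `IsShift`. We record the facts on their
behaviour outside of a disc that are used later on. -/
lemma exists_isShift {s : ℂ} (hs : s ≠ 0) (hs1 : ‖s‖ < 1) :
    ∃ M K C : ℝ, IsShift (hat s) M K C ∧ IsShift (check s) M K C ∧
      (∀ x : ℂ, M < ‖x‖ → ‖hat s x‖ ≤ ‖x‖) ∧ (∀ x : ℂ, M < ‖x‖ → check s (hat s x) = x) ∧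
      (∀ x : ℂ, M < ‖x‖ → 1 < ‖hat s x‖) ∧ (∀ x : ℂ, M < ‖x‖ → 1 < ‖check s x‖) ∧
      (∀ x : ℂ, M < ‖x‖ → 1 ≤ ‖hat s x - check s x‖) ∧
      (∀ x : ℂ, M < ‖x‖ → ‖s‖⁻¹ + 1 < 2 * ‖x‖) := by
  have hs0 : 0 < ‖s‖ := norm_pos_iff.2 hs
  have hsi : 1 < ‖s‖⁻¹ := (one_lt_inv₀ hs0).2 hs1
  have hd : 0 < ‖s - s⁻¹‖ := norm_pos_iff.2 (sub_inv_ne_zero hs hs1)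
  set c := (‖s‖ + ‖s‖⁻¹) / 2 with hc
  have hc0 : 0 < c := by positivity
  set e := ‖(s - s⁻¹) ^ 2 / 4‖ with he
  have he0 : 0 ≤ e := norm_nonneg _
  have h1s : 0 < 1 - ‖s‖ := by linarith
  -- The terms secure in turn `e ≤ M²`, `|x̂| ≤ |x|`, that both shifts leave the unit disc, that
  -- `|x̂ - x̌| ≥ 1`, and that `check` inverts `hat`.
  set M := 1 + e + c / (1 - ‖s‖) + (c + 1) * ‖s‖⁻¹ + 1 / ‖s - s⁻¹‖ + ‖s‖⁻¹ with hM
  have t1 : 0 ≤ c / (1 - ‖s‖) := by positivity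
  have t2 : 0 ≤ (c + 1) * ‖s‖⁻¹ := by positivity
  have t3 : 0 ≤ 1 / ‖s - s⁻¹‖ := by positivity
  have t4 : 0 ≤ ‖s‖⁻¹ := by positivity
  have hM1 : 1 ≤ M := by linarith
  have hMe : e ≤ M ^ 2 := by nlinarith
  set K := ‖s‖⁻¹ + c with hK
  have hK1 : 1 ≤ K := by linarith
  have hhat : ∀ x : ℂ, M < ‖x‖ → ‖hat s x‖ ≤ ‖x‖ := by
    intro x hx
    have h := norm_hat_le s x
    have : c ≤ (1 - ‖s‖) * ‖x‖ := by
      rw [← div_le_iff₀' h1s]; linarith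
    nlinarith
  have hhatK : ∀ x : ℂ, M < ‖x‖ → ‖hat s x‖ ≤ K * ‖x‖ := by
    intro x hx
    have := hhat x hx
    nlinarith [norm_nonneg x]
  have hcheckK : ∀ x : ℂ, M < ‖x‖ → ‖check s x‖ ≤ K * ‖x‖ := by
    intro x hx
    have h := norm_check_le s x
    have hx1 : 1 ≤ ‖x‖ := by linarith
    rw [hK]
    nlinarith
  have hinv : ∀ x : ℂ, M < ‖x‖ → ‖s‖⁻¹ + 1 < 2 * ‖x‖ := by
    intro x hx; linarith
  have hch : ∀ x : ℂ, M < ‖x‖ → check s (hat s x) = x := fun x hx => check_hat hs (hinv x hx)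
  have han1 : ∀ x : ℂ, M < ‖x‖ → AnalyticAt ℂ (hat s) x := fun x hx =>
    analyticAt_hat (by linarith)
  have han2 : ∀ x : ℂ, M < ‖x‖ → AnalyticAt ℂ (check s) x := fun x hx =>
    analyticAt_check (by linarith)
  have hprod := norm_sq_sub_le_norm_hat_mul hs
  refine ⟨M, K, log (2 * (K + 1)), ⟨hM1, hK1, han1, ?_, hhatK, ?_⟩, ⟨hM1, hK1, han2, ?_, hcheckK, ?_⟩,
    hhat, hch, ?_, ?_, ?_, hinv⟩
  · intro x hx y hy hxy
    rw [← hch x hx, ← hch y hy, hxy]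
  · exact fun u r hr => le_circleAverage_log_norm_sub hM1 hK1 hMe (hat_sub_mul_check_sub hs) hprod
      han1 han2 hcheckK u hr
  · intro x _ y _ hxy
    rw [← hat_check hs hs1 x, ← hat_check hs hs1 y, hxy]
  · exact fun u r hr => le_circleAverage_log_norm_sub hM1 hK1 hMe
      (fun x u => by rw [mul_comm, hat_sub_mul_check_sub hs, mul_comm])
      (fun u => by rw [mul_comm]; exact hprod u) han2 han1 hhatK u hr
  · intro x hx
    have h := le_norm_hat s x
    have : c + 1 < ‖s‖ * ‖x‖ := by
      rw [← div_lt_iff₀' hs0, div_eq_mul_inv]; linarith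
    linarith
  · intro x hx
    have h := le_norm_check s x
    have : c + 1 < ‖s‖⁻¹ * ‖x‖ := by
      have h1 : c + 1 ≤ (c + 1) * ‖s‖⁻¹ := by nlinarith
      nlinarith
    linarith
  · intro x hx
    refine le_trans ?_ (le_norm_hat_sub_check s x)
    rw [← div_le_iff₀' hd]
    linarith

/-! ### Growth of transcendental functions -/

/-- Any `N` points of the support lie in the disc of radius `√r` for large `r`, so `N log √r ≤
E.logCounting r ≤ B log r` for some such `r`, which forces `N ≤ 2 B`. -/
lemma finite_support_of_frequently {E : Function.locallyFinsupp ℂ ℤ} (hE : 0 ≤ E) {B : ℝ}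
    (h : ∃ᶠ r in atTop, E.logCounting r ≤ B * log r) : E.support.Finite := by
  by_contra hinf
  obtain ⟨N, hN⟩ := exists_nat_gt (2 * B)
  obtain ⟨Z, hZs, hZc⟩ := Set.Infinite.exists_subset_card_eq (s := E.support) hinf N
  obtain ⟨ρ, hρ⟩ := (Z.finite_toSet.isBounded).exists_norm_le
  obtain ⟨r, hr, hr1, hr2⟩ := (h.and_eventually
    ((eventually_ge_atTop (ρ ^ 2)).and (eventually_gt_atTop 1))).exists
  have hsq : 1 ≤ √r := Real.one_le_sqrt.2 hr2.le
  have hle := sum_mul_log_le hE hsq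
  rw [sq_sqrt (by linarith), log_sqrt (by linarith)] at hle
  have hlog := log_pos hr2
  have hcard : (N : ℝ) ≤ ∑ z ∈ (finite_ball_support E √r).toFinset, (E z : ℝ) := by
    calc (N : ℝ) = ∑ z ∈ Z, (1 : ℝ) := by simp [hZc]
      _ ≤ ∑ z ∈ Z, (E z : ℝ) := by
          refine Finset.sum_le_sum fun z hz => ?_
          have h1 : E z ≠ 0 := hZs hz
          have h2 : 0 ≤ E z := hE z
          have : 1 ≤ E z := by omega
          exact_mod_cast this
      _ ≤ _ := by
          refine Finset.sum_le_sum_of_subset_of_nonneg (fun z hz => ?_) fun z _ _ => ?_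
          · simp only [Set.Finite.mem_toFinset, Set.mem_ofPred_eq]
            exact ⟨Real.le_sqrt_of_sq_le
              (le_trans (pow_le_pow_left₀ (norm_nonneg _) (hρ z hz) 2) hr1), hZs hz⟩
          · exact_mod_cast hE z
  nlinarith

lemma zpow_eq_div (a : ℂ) (n : ℤ) : a ^ n = a ^ n.toNat / a ^ (-n).toNat := by
  rcases le_total 0 n with h | h
  · rw [Int.toNat_of_nonpos (by omega : -n ≤ 0), pow_zero, div_one]
    conv_lhs => rw [← Int.toNat_of_nonneg h]
    rw [zpow_natCast]
  · rw [Int.toNat_of_nonpos h, pow_zero, one_div]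
    conv_lhs => rw [← neg_neg n, ← Int.toNat_of_nonneg (by omega : 0 ≤ -n)]
    rw [zpow_neg, zpow_natCast]

/-- The Poisson estimate bounds `|log |h w| - log |h 0||` by a multiple of `log r / r` along a
sequence of radii. So `|h|` is constant, and Liouville's theorem applies. -/
lemma constant_of_frequently {h : ℂ → ℂ} (hh : ∀ x, AnalyticAt ℂ h x) (h0 : ∀ x, h x ≠ 0) {B : ℝ}
    (hB : ∃ᶠ r in atTop, circleAverage (fun x => |log ‖h x‖|) 0 r ≤ B * log r) :
    ∀ x, h x = h 0 := by
  have hlog : ∀ w, log ‖h w‖ = log ‖h 0‖ := by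
    intro w
    by_contra hne
    have hpos : 0 < |log ‖h w‖ - log ‖h 0‖| := abs_pos.2 (sub_ne_zero.2 hne)
    have hlim : Tendsto (fun r : ℝ => 4 * ‖w‖ * B * (log r / r)) atTop (𝓝 0) := by
      have := Real.isLittleO_log_id_atTop.tendsto_div_nhds_zero
      simpa using this.const_mul (4 * ‖w‖ * B)
    obtain ⟨r, hr, hr1, hr2, hr3⟩ := (hB.and_eventually ((hlim.eventually_lt_const hpos).and
      ((eventually_gt_atTop 0).and (eventually_ge_atTop (2 * ‖w‖))))).exists
    have p1 := abs_log_norm_sub_circleAverage_le hr2 (fun x _ => hh x) (fun x _ => h0 x)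
      (w := w) (by linarith)
    have p2 := abs_log_norm_sub_circleAverage_le hr2 (fun x _ => hh x) (fun x _ => h0 x)
      (w := 0) (by rw [norm_zero]; linarith)
    rw [norm_zero, mul_zero, zero_div, zero_mul] at p2
    have p3 : log ‖h 0‖ = circleAverage (fun x => log ‖h x‖) 0 r :=
      sub_eq_zero.1 (abs_nonpos_iff.1 p2)
    rw [← p3] at p1
    have p4 : 4 * ‖w‖ / r * circleAverage (fun x => |log ‖h x‖|) 0 r ≤
        4 * ‖w‖ / r * (B * log r) := by gcongr
    have p5 : 4 * ‖w‖ / r * (B * log r) = 4 * ‖w‖ * B * (log r / r) := by ring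
    linarith
  have hnorm : ∀ w, ‖h w‖ = ‖h 0‖ := fun w =>
    log_injOn_pos (norm_pos_iff.2 (h0 w)) (norm_pos_iff.2 (h0 0)) (hlog w)
  have hdiff : Differentiable ℂ h := fun x => (hh x).differentiableAt
  intro x
  refine hdiff.apply_eq_apply_of_bounded ?_ x 0
  refine isBounded_iff_forall_norm_le.2 ⟨‖h 0‖, ?_⟩
  rintro _ ⟨w, rfl⟩
  exact (hnorm w).le

/-- A function vanishing to infinite order somewhere is zero. -/
lemma _root_.Meromorphic.meromorphicOrderAt_ne_top {g : ℂ → ℂ} (hg : Meromorphic g)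
    (h : ¬ g =ᶠ[codiscrete ℂ] fun _ => 0) (z : ℂ) : meromorphicOrderAt g z ≠ ⊤ := by
  intro htop
  apply h
  rw [Filter.EventuallyEq, Filter.Eventually, codiscrete,
    mem_codiscreteWithin_iff_forall_mem_nhdsNE]
  intro w _
  have hw : meromorphicOrderAt g w = ⊤ := by
    by_contra hw
    exact (hg.meromorphicOn (s := Set.univ)).meromorphicOrderAt_ne_top_of_isPreconnected
      isPreconnected_univ (Set.mem_univ w) (Set.mem_univ z) hw htop
  filter_upwards [meromorphicOrderAt_eq_top_iff.1 hw] with x hx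
  left
  exact hx

lemma IsTranscendental.meromorphicOrderAt_sub_ne_top {f : ℂ → ℂ} (hf : Meromorphic f)
    (htr : IsTranscendental f) (a : ℂ) (z : ℂ) : meromorphicOrderAt (fun x => f x - a) z ≠ ⊤ := by
  refine Meromorphic.meromorphicOrderAt_ne_top (fun x => (hf x).sub (MeromorphicAt.const a x))
    (fun h => htr ⟨Polynomial.C a, 1, one_ne_zero, ?_⟩) z
  filter_upwards [h] with x hx
  simpa [sub_eq_zero] using hx

/-- The characteristic of a transcendental function grows faster than `log r`. -/
theorem IsTranscendental.eventually_mul_log_le {f : ℂ → ℂ} (hf : Meromorphic f)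
    (htr : IsTranscendental f) (B : ℝ) :
    ∀ᶠ r in atTop, B * log r ≤ ValueDistribution.characteristic f ⊤ r := by
  -- If `T(r) < B log r` for arbitrarily large `r`, then `f` has finitely many zeros and poles and
  -- its zero-free factor is constant, so `f` is rational.
  by_contra hcon
  rw [not_eventually] at hcon
  simp only [not_le] at hcon
  obtain ⟨C, hC, hCr⟩ := exists_circleAverage_abs_log_norm_le hf
  have hne : ∀ z, meromorphicOrderAt f z ≠ ⊤ := by
    have := htr.meromorphicOrderAt_sub_ne_top hf 0
    simpa using this
  set D := MeromorphicOn.divisor f Set.univ with hD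
  have hE0 : 0 ≤ D⁺ + D⁻ := add_nonneg (posPart_nonneg _) (negPart_nonneg _)
  have hEabs : ∀ u, (D⁺ + D⁻) u = |D u| := fun u => posPart_add_negPart (D u)
  have hfinE : (D⁺ + D⁻).support.Finite := by
    refine finite_support_of_frequently hE0 (B := 2 * B + |log ‖f 0‖|
      + |log ‖meromorphicTrailingCoeffAt f 0‖|) ?_
    refine (hcon.and_eventually (eventually_ge_atTop (exp 1))).mono ?_
    rintro r ⟨hr, hre⟩
    have hr1 : 1 ≤ r := (one_le_exp (by norm_num)).trans hre
    have hlog1 : 1 ≤ log r := by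
      rw [le_log_iff_exp_le (by linarith)]; exact hre
    rw [map_add, Pi.add_apply, hD, ← ValueDistribution.logCounting_zero,
      ← ValueDistribution.logCounting_top, ← ValueDistribution.logCounting_inv]
    have h1 := ValueDistribution.characteristic_sub_characteristic_inv_le (R := r) hf
    have h4 := neg_le_of_abs_le h1
    have p1 := ValueDistribution.proximity_nonneg (f := f) (a := ⊤) r
    have p2 := ValueDistribution.proximity_nonneg (f := f⁻¹) (a := ⊤) r
    have e1 : ValueDistribution.characteristic f ⊤ r =
      ValueDistribution.proximity f ⊤ r + ValueDistribution.logCounting f ⊤ r := rfl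
    have e2 : ValueDistribution.characteristic f⁻¹ ⊤ r =
      ValueDistribution.proximity f⁻¹ ⊤ r + ValueDistribution.logCounting f⁻¹ ⊤ r := rfl
    simp only [Pi.zero_apply] at p1 p2
    have q1 := abs_nonneg (log ‖f 0‖)
    have q2 := abs_nonneg (log ‖meromorphicTrailingCoeffAt f 0‖)
    have q3 : max |log ‖f 0‖| |log ‖meromorphicTrailingCoeffAt f 0‖| ≤
        |log ‖f 0‖| + |log ‖meromorphicTrailingCoeffAt f 0‖| :=
      max_le (by linarith) (by linarith)
    have q4 : |log ‖f 0‖| + |log ‖meromorphicTrailingCoeffAt f 0‖| ≤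
        (|log ‖f 0‖| + |log ‖meromorphicTrailingCoeffAt f 0‖|) * log r :=
      le_mul_of_one_le_right (by linarith) hlog1
    linarith
  have hfin : D.support.Finite := by
    refine hfinE.subset fun u hu => ?_
    rw [Function.mem_support, hEabs]
    exact abs_ne_zero.2 hu
  obtain ⟨h, hh, hh0, hfh⟩ := (hf.meromorphicOn (s := Set.univ)).extract_zeros_poles
    (fun u => hne u) hfin
  have hlogeq := MeromorphicOn.extract_zeros_poles_log hh0 hfh
  set Z := hfin.toFinset with hZ
  have hsum : ∀ x, (∑ᶠ u, ((D u : ℝ) * log ‖· - u‖) + (log ‖h ·‖)) x =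
      ∑ u ∈ Z, (D u : ℝ) * log ‖x - u‖ + log ‖h x‖ := by
    intro x
    rw [Pi.add_apply]
    congr 1
    rw [finsum_eq_sum_of_support_subset (s := Z), Finset.sum_apply]
    intro u hu
    rw [Function.mem_support] at hu
    rw [hZ, Set.Finite.coe_toFinset]
    intro h'; apply hu; ext y; simp [h']
  have hlogeq2 : ∀ᶠ x in codiscreteWithin (Set.univ : Set ℂ),
      log ‖f x‖ = ∑ u ∈ Z, (D u : ℝ) * log ‖x - u‖ + log ‖h x‖ := by
    filter_upwards [hlogeq] with x hx
    rw [← hsum x, ← hx]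
  have hconst : ∀ x, h x = h 0 := by
    refine constant_of_frequently (fun x => hh x (Set.mem_univ x))
      (fun x => hh0 ⟨x, Set.mem_univ x⟩)
      (B := 2 * B + C + ∑ u ∈ Z, |(D u : ℝ)| * 4) ?_
    have hbig : ∀ᶠ r : ℝ in atTop, ∀ u ∈ Z, r + ‖u‖ + 1 ≤ r ^ 2 := by
      rw [Filter.eventually_all_finset]
      intro u _
      filter_upwards [eventually_ge_atTop (2 + ‖u‖)] with r hr
      nlinarith [norm_nonneg u]
    refine (hcon.and_eventually ((eventually_ge_atTop (exp 1)).and hbig)).mono ?_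
    rintro r ⟨hr, hre, hru⟩
    have hr1 : 1 ≤ r := (one_le_exp (by norm_num)).trans hre
    have hlog1 : 1 ≤ log r := by
      rw [le_log_iff_exp_le (by linarith)]; exact hre
    have h1 := circleAverage_abs_log_norm_factor_le hr1 hf
      (fun x _ => (hh x (Set.mem_univ x)).meromorphicAt)
      (hlogeq2.filter_mono (codiscreteWithin_mono (Set.subset_univ _)))
    refine h1.trans ?_
    rw [add_mul, Finset.sum_mul]
    refine add_le_add ?_ (Finset.sum_le_sum fun u hu => ?_)
    · have := hCr r hr1
      nlinarith
    · rw [mul_assoc]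
      refine mul_le_mul_of_nonneg_left ?_ (abs_nonneg _)
      have : log (r + ‖u‖ + 1) ≤ log (r ^ 2) := log_le_log (by positivity) (hru u hu)
      rw [log_pow] at this
      push_cast at this
      linarith
  apply htr
  refine ⟨Polynomial.C (h 0) * ∏ u ∈ Z, (Polynomial.X - Polynomial.C u) ^ (D u).toNat,
    ∏ u ∈ Z, (Polynomial.X - Polynomial.C u) ^ (-D u).toNat,
    Finset.prod_ne_zero_iff.2 fun u _ => pow_ne_zero _ (Polynomial.X_sub_C_ne_zero u), ?_⟩
  filter_upwards [hfh] with x hx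
  rw [hx, Pi.smul_apply', smul_eq_mul, hconst x, Function.FactorizedRational.finprod_eq_fun hfin]
  change (∏ᶠ u, (x - u) ^ D u) * h 0 = _
  rw [finprod_eq_prod_of_mulSupport_subset (s := Z)]
  · simp only [Polynomial.eval_mul, Polynomial.eval_C, Polynomial.eval_prod, Polynomial.eval_pow,
      Polynomial.eval_sub, Polynomial.eval_X]
    rw [Finset.prod_congr rfl fun u _ => zpow_eq_div (x - u) (D u), Finset.prod_div_distrib]
    ring
  · intro u hu
    rw [hZ, Set.Finite.coe_toFinset]
    intro h'
    apply hu
    simp [h']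

/-- A function of finite logarithmic order satisfies a doubling condition along a sequence. -/
lemma exists_frequently_pow_four_le {T : ℝ → ℝ}
    (hT : limsup (fun r : ℝ => ((log (T r) / log (log r) : ℝ) : EReal)) atTop < ⊤)
    (hlog : ∀ᶠ r in atTop, log r ≤ T r) :
    ∃ C, 0 ≤ C ∧ ∃ᶠ r in atTop, T (r ^ 4) ≤ C * T r := by
  obtain ⟨σ, hσ, -⟩ := EReal.lt_iff_exists_real_btwn.1 hT
  have hlt := eventually_lt_of_limsup_lt hσ
  -- If `T(r⁴) > exp b * T(r)` for all large `r`, iteration gives `log T(R^(4^k)) ≥ log T(R) + k b`.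
  -- Logarithmic order below `σ` allows only `k |σ| log 4 + O(1)`, and `b` exceeds this slope by
  -- `log 4`.
  set b := (|σ| + 1) * log 4 with hb
  refine ⟨exp b, (exp_pos _).le, ?_⟩
  by_contra hcon
  rw [not_frequently] at hcon
  obtain ⟨r₀, hr₀⟩ := eventually_atTop.1
    (hcon.and (hlt.and (hlog.and (eventually_ge_atTop (exp (exp 1))))))
  set R := max r₀ (exp (exp 1)) with hR
  have hRe : exp (exp 1) ≤ R := le_max_right _ _
  have hlogR : exp 1 ≤ log R := by rwa [le_log_iff_exp_le ((exp_pos _).trans_le hRe)]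
  have hlog1 : 1 ≤ log R := (one_le_exp (by norm_num)).trans hlogR
  have hloglog : 1 ≤ log (log R) := by rwa [le_log_iff_exp_le (by linarith)]
  have hR1 : 1 ≤ R := (one_le_exp (exp_pos 1).le).trans hRe
  have hge : ∀ k : ℕ, r₀ ≤ R ^ 4 ^ k := fun k =>
    (le_max_left _ _).trans (le_self_pow₀ hR1 (by positivity))
  have hT1 : ∀ k : ℕ, 0 < T (R ^ 4 ^ k) := by
    intro k
    have h1 := (hr₀ _ (hge k)).2.2.1
    rw [log_pow] at h1
    refine lt_of_lt_of_le ?_ h1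
    positivity
  have hgrow : ∀ k : ℕ, log (T R) + k * b ≤ log (T (R ^ 4 ^ k)) := by
    intro k
    induction k with
    | zero => simp
    | succ k ih =>
      have h1 := (hr₀ _ (hge k)).1
      rw [not_le, ← pow_mul, ← pow_succ] at h1
      have h2 := log_le_log (mul_pos (exp_pos b) (hT1 k)) h1.le
      rw [log_mul (exp_pos _).ne' (hT1 k).ne', log_exp] at h2
      push_cast
      linarith
  have h4 : 1 ≤ log 4 := by
    rw [le_log_iff_exp_le (by norm_num)]
    linarith [exp_one_lt_d9]
  have hup : ∀ k : ℕ, log (T (R ^ 4 ^ k)) ≤ |σ| * (k * log 4 + log (log R)) := by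
    intro k
    have h1 := (hr₀ _ (hge k)).2.1
    have h2 : log (log (R ^ 4 ^ k)) = k * log 4 + log (log R) := by
      rw [log_pow, log_mul (by positivity) (by linarith)]
      push_cast
      rw [log_pow]
    have h3 : 0 < log (log (R ^ 4 ^ k)) := by rw [h2]; positivity
    rw [EReal.coe_lt_coe_iff, div_lt_iff₀ h3, h2] at h1
    rw [h2] at h3
    have := le_abs_self σ
    nlinarith
  obtain ⟨k, hk⟩ := exists_nat_gt (|σ| * log (log R) - log (T R))
  have h1 := hgrow k
  have h2 := hup k
  have : (k : ℝ) ≤ k * log 4 := le_mul_of_one_le_right (Nat.cast_nonneg k) h4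
  rw [hb] at h1
  nlinarith

end AskeyWilson

namespace AskeyWilson

open Real Metric ValueDistribution

/-! ### Estimates for the proximity functions -/

/-- The error term of the second main theorem. -/
noncomputable def growthError (f : ℂ → ℂ) (r : ℝ) : ℝ :=
  log r + (1 + characteristic f ⊤ (r ^ 4)) / log r

lemma log_le_growthError (f : ℂ → ℂ) {r : ℝ} (hr : 1 ≤ r) : log r ≤ growthError f r := by
  have h1 : 0 ≤ characteristic f ⊤ (r ^ 4) := characteristic_nonneg (one_le_pow₀ hr)
  have h2 := log_nonneg hr
  unfold growthError
  have : 0 ≤ (1 + characteristic f ⊤ (r ^ 4)) / log r := by positivity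
  linarith

lemma div_log_le_growthError (f : ℂ → ℂ) {r : ℝ} (hr : 1 ≤ r) :
    (1 + characteristic f ⊤ (r ^ 4)) / log r ≤ growthError f r := by
  have h2 := log_nonneg hr
  unfold growthError
  linarith

lemma one_le_growthError (f : ℂ → ℂ) {r : ℝ} (hr : exp 1 ≤ r) : 1 ≤ growthError f r := by
  have h1 : 1 ≤ r := (one_le_exp (by norm_num)).trans hr
  have h2 : 1 ≤ log r := by rwa [le_log_iff_exp_le (by linarith)]
  exact h2.trans (log_le_growthError f h1)

variable {s : ℂ} {f : ℂ → ℂ}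

lemma awOp_sub_const (s : ℂ) (f : ℂ → ℂ) (a : ℂ) : awOp s (fun x => f x - a) = awOp s f := by
  ext x
  unfold awOp
  rw [deriv_sub_const, sub_sub_sub_cancel_right]

lemma IsShift.circleIntegrable_posLog {σ : ℂ → ℂ} {M K C : ℝ} (hσ : IsShift σ M K C)
    (hf : Meromorphic f) {r : ℝ} (hr : M < r) :
    CircleIntegrable (fun x => log⁺ ‖f (σ x) / f x‖) 0 r := by
  have hM := hσ.one_le_radius
  have : MeromorphicOn (fun x => f (σ x) / f x) (sphere 0 |r|) := by
    intro x hx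
    rw [abs_of_pos (by linarith), mem_sphere_zero_iff_norm] at hx
    exact ((hf _).comp_analyticAt (hσ.analyticAt x (by linarith))).div (hf x)
  exact this.circleIntegrable_posLog_norm

/-- The lemma on the logarithmic difference for the Askey-Wilson operator. -/
lemma exists_circleAverage_posLog_awOp_div_le (hs : s ≠ 0) (hs1 : ‖s‖ < 1) (hf : Meromorphic f)
    {a : ℂ} (hne : ∀ z, meromorphicOrderAt (fun x => f x - a) z ≠ ⊤) :
    ∃ A, 0 ≤ A ∧ ∀ᶠ r in atTop,
      circleAverage (fun x => log⁺ ‖awOp s f x / (f x - a)‖) 0 r ≤ A * growthError f r := by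
  obtain ⟨M, K, C, hσ, hτ, -, -, -, -, hW, -⟩ := exists_isShift hs hs1
  set g : ℂ → ℂ := fun x => f x - a with hg
  have hgm : Meromorphic g := fun x => (hf x).sub (MeromorphicAt.const a x)
  obtain ⟨A₁, hA₁, h₁⟩ := hσ.exists_circleAverage_posLog_le hgm hne
  obtain ⟨A₂, hA₂, h₂⟩ := hτ.exists_circleAverage_posLog_le hgm hne
  have hM := hσ.one_le_radius
  set c := log⁺ ‖a‖ + log 2 with hc
  have hc0 : 0 ≤ c := add_nonneg posLog_nonneg (log_nonneg (by norm_num))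
  refine ⟨(A₁ + A₂) * (1 + c) + log 2, by positivity, ?_⟩
  filter_upwards [h₁, h₂, eventually_gt_atTop M, eventually_ge_atTop (exp 1)]
    with r hr₁ hr₂ hrM hre
  have hr1 : 1 < r := by linarith
  have hlog := log_pos hr1
  have hchar : characteristic g ⊤ (r ^ 4) ≤ characteristic f ⊤ (r ^ 4) + c := by
    have := abs_le.1 (abs_characteristic_sub_characteristic_shift_le (r := r ^ 4) (a₀ := a) hf)
    linarith [this.1]
  have hT0 : 0 ≤ characteristic f ⊤ (r ^ 4) := characteristic_nonneg (one_le_pow₀ hr1.le)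
  have hQ : (1 + characteristic g ⊤ (r ^ 4)) / log r ≤ (1 + c) * growthError f r := by
    refine le_trans ?_ (mul_le_mul_of_nonneg_left (div_log_le_growthError f hr1.le) (by positivity))
    rw [← mul_div_assoc]
    gcongr
    nlinarith
  have i₁ := hσ.circleIntegrable_posLog hgm hrM
  have i₂ := hτ.circleIntegrable_posLog hgm hrM
  have i₁₂ : CircleIntegrable
      (fun x => log⁺ ‖g (hat s x) / g x‖ + log⁺ ‖g (check s x) / g x‖) 0 r := i₁.add i₂
  have i₃ : CircleIntegrable (fun x => log⁺ ‖awOp s f x / g x‖) 0 r := by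
    have : Meromorphic (fun x => awOp s f x / g x) := fun x => (meromorphic_awOp hf x).div (hgm x)
    exact this.meromorphicOn.circleIntegrable_posLog_norm
  have hle : circleAverage (fun x => log⁺ ‖awOp s f x / g x‖) 0 r ≤
      circleAverage (fun x => log 2 + (log⁺ ‖g (hat s x) / g x‖ + log⁺ ‖g (check s x) / g x‖)) 0 r
      := by
    refine circleAverage_mono i₃ ((circleIntegrable_const _ _ _).add i₁₂) ?_
    intro x hx
    rw [abs_of_pos (by linarith), mem_sphere_zero_iff_norm] at hx
    have hx1 : x ≠ 1 ∧ x ≠ -1 := by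
      constructor <;> rintro rfl <;> simp at hx <;> linarith
    have hWx := hW x (by linarith)
    have e : awOp s f x / g x = (g (hat s x) / g x - g (check s x) / g x) /
        (hat s x - check s x) := by
      rw [← awOp_sub_const s f a, awOp, if_neg (by tauto)]
      ring
    have h3 : ‖awOp s f x / g x‖ ≤ ‖g (hat s x) / g x‖ + ‖g (check s x) / g x‖ := by
      rw [e, norm_div]
      exact (div_le_self (norm_nonneg _) hWx).trans (norm_sub_le _ _)
    have := (posLog_le_posLog (norm_nonneg _) h3).trans posLog_add
    linarith
  rw [circleAverage_fun_add (circleIntegrable_const _ _ _) i₁₂, circleAverage_const,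
    circleAverage_fun_add i₁ i₂] at hle
  have h6 : log 2 ≤ log 2 * growthError f r :=
    le_mul_of_one_le_right (log_nonneg (by norm_num)) (one_le_growthError f hre)
  have h7 := mul_le_mul_of_nonneg_left hQ hA₁
  have h8 := mul_le_mul_of_nonneg_left hQ hA₂
  linarith

lemma exists_pos_forall_le_norm_sub (S : Finset ℂ) :
    ∃ δ > 0, ∀ a ∈ S, ∀ b ∈ S, a ≠ b → δ ≤ ‖a - b‖ := by
  classical
  induction S using Finset.induction_on with
  | empty => exact ⟨1, one_pos, by simp⟩
  | insert c S hc ih =>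
    obtain ⟨δ, hδ, h⟩ := ih
    obtain ⟨ε, hε, h'⟩ : ∃ ε > 0, ∀ b ∈ S, ε ≤ ‖c - b‖ := by
      rcases S.eq_empty_or_nonempty with rfl | hS
      · exact ⟨1, one_pos, by simp⟩
      · obtain ⟨b, hb, hmin⟩ := S.exists_min_image (fun b => ‖c - b‖) hS
        exact ⟨‖c - b‖, norm_pos_iff.2 (sub_ne_zero.2 fun h => hc (h ▸ hb)), hmin⟩
    refine ⟨min δ ε, lt_min hδ hε, fun a ha b hb hab => ?_⟩
    rcases Finset.mem_insert.1 ha with rfl | ha' <;>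
      rcases Finset.mem_insert.1 hb with rfl | hb'
    · exact absurd rfl hab
    · exact (min_le_right _ _).trans (h' b hb')
    · rw [norm_sub_rev]; exact (min_le_right _ _).trans (h' a ha')
    · exact (min_le_left _ _).trans (h a ha' b hb' hab)

/-- A value `w` is close to at most one point `a` of `S`. For that one, `(w - a)⁻¹ = (F / (w - a)) *
F⁻¹`, and the other terms are bounded by the separation of `S`. Thus `F⁻¹` is paid for once, not
once for every `a`. -/
lemma exists_sum_posLog_inv_le (S : Finset ℂ) :
    ∃ C, ∀ w F : ℂ, F ≠ 0 → ∑ a ∈ S, log⁺ ‖(w - a)⁻¹‖ ≤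
      ∑ a ∈ S, log⁺ ‖F / (w - a)‖ + log⁺ ‖F⁻¹‖ + C := by
  classical
  obtain ⟨δ, hδ, hsep⟩ := exists_pos_forall_le_norm_sub S
  refine ⟨S.card * log⁺ (2 / δ), fun w F hF => ?_⟩
  have hfar : ∀ a, δ / 2 ≤ ‖w - a‖ → log⁺ ‖(w - a)⁻¹‖ ≤ log⁺ (2 / δ) := by
    intro a ha
    refine posLog_le_posLog (norm_nonneg _) ?_
    rw [norm_inv, ← inv_div]
    exact inv_anti₀ (by positivity) ha
  have hnn : ∀ a ∈ S, 0 ≤ log⁺ ‖F / (w - a)‖ := fun a _ => posLog_nonneg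
  by_cases hex : ∃ a ∈ S, ‖w - a‖ < δ / 2
  · obtain ⟨a, ha, haδ⟩ := hex
    rw [← Finset.add_sum_erase S _ ha]
    have h1 : log⁺ ‖(w - a)⁻¹‖ ≤ log⁺ ‖F / (w - a)‖ + log⁺ ‖F⁻¹‖ := by
      refine le_trans (le_of_eq ?_) posLog_mul
      rw [← norm_mul]
      congr 2
      field_simp
    have h2 : ∑ b ∈ S.erase a, log⁺ ‖(w - b)⁻¹‖ ≤ S.card * log⁺ (2 / δ) := by
      calc _ ≤ ∑ b ∈ S.erase a, log⁺ (2 / δ) := by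
            refine Finset.sum_le_sum fun b hb => hfar b ?_
            have h3 := hsep a ha b (Finset.mem_of_mem_erase hb) (Finset.ne_of_mem_erase hb).symm
            have h4 := norm_sub_le_norm_sub_add_norm_sub a w b
            rw [norm_sub_rev a w] at h4
            linarith
        _ ≤ _ := by
            rw [Finset.sum_const, nsmul_eq_mul]
            have : ((S.erase a).card : ℝ) ≤ S.card := by
              exact_mod_cast Finset.card_le_card (Finset.erase_subset a S)
            exact mul_le_mul_of_nonneg_right this posLog_nonneg
    have h3 := Finset.single_le_sum hnn ha
    linarith
  · push Not at hex
    have h2 : ∑ b ∈ S, log⁺ ‖(w - b)⁻¹‖ ≤ S.card * log⁺ (2 / δ) := by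
      rw [← nsmul_eq_mul, ← Finset.sum_const]
      exact Finset.sum_le_sum fun b hb => hfar b (hex b hb)
    have h3 := Finset.sum_nonneg hnn
    have h4 : 0 ≤ log⁺ ‖F⁻¹‖ := posLog_nonneg
    linarith

lemma proximity_coe_eq (f : ℂ → ℂ) (a : ℂ) (r : ℝ) :
    proximity f a r = circleAverage (fun x => log⁺ ‖(f x - a)⁻¹‖) 0 r := by
  rw [proximity_coe]
  simp_rw [norm_inv]

/-- Nevanlinna's first main theorem. -/
lemma exists_abs_characteristic_sub_le (hf : Meromorphic f) (a : ℂ) :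
    ∃ C, ∀ r, |characteristic f ⊤ r - (logCounting f a r + proximity f a r)| ≤ C := by
  have hgm : Meromorphic (fun x => f x - a) := fun x => (hf x).sub (MeromorphicAt.const a x)
  refine ⟨log⁺ ‖a‖ + log 2 + max |log ‖f 0 - a‖|
    |log ‖meromorphicTrailingCoeffAt (fun x => f x - a) 0‖|, fun r => ?_⟩
  have h1 := abs_characteristic_sub_characteristic_shift_le (r := r) (a₀ := a) hf
  have h2 := characteristic_sub_characteristic_inv_le (R := r) hgm
  have h3 : characteristic (fun x => f x - a)⁻¹ ⊤ r = logCounting f a r + proximity f a r := by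
    rw [characteristic, Pi.add_apply, proximity_inv, logCounting_inv, add_comm,
      logCounting_coe_eq_logCounting_sub_const_zero, proximity_coe_eq_proximity_sub_const_zero]
    rfl
  rw [h3] at h2
  exact (abs_sub_le _ _ _).trans (add_le_add h1 h2)

/-- The main estimate of proximity functions towards the second main theorem. -/
lemma exists_sum_characteristic_sub_logCounting_le (hs : s ≠ 0) (hs1 : ‖s‖ < 1)
    (hf : Meromorphic f) (hne : ∀ a z, meromorphicOrderAt (fun x => f x - a) z ≠ ⊤)
    (hD : ¬ awOp s f =ᶠ[codiscrete ℂ] fun _ => 0) (S : Finset ℂ) :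
    ∃ A, 0 ≤ A ∧ ∀ᶠ r in atTop, ∑ a ∈ S, (characteristic f ⊤ r - logCounting f a r) +
      (MeromorphicOn.divisor (awOp s f) Set.univ).logCounting r ≤
        characteristic f ⊤ r - logCounting f ⊤ r + A * growthError f r := by
  classical
  set F := awOp s f with hF
  have hFm : Meromorphic F := meromorphic_awOp hf
  have hFne := hFm.meromorphicOrderAt_ne_top hD
  choose! A hA0 hA using fun a => exists_circleAverage_posLog_awOp_div_le hs hs1 hf (hne a)
  choose! B hB using fun a => exists_abs_characteristic_sub_le hf a
  obtain ⟨C, hC⟩ := exists_sum_posLog_inv_le S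
  set L := |log ‖meromorphicTrailingCoeffAt F 0‖| with hL
  refine ⟨∑ a ∈ S, A a + A 0 + ∑ a ∈ S, |B a| + |C| + L,
    add_nonneg (add_nonneg (add_nonneg (add_nonneg (Finset.sum_nonneg fun a _ => hA0 a) (hA0 0))
      (Finset.sum_nonneg fun a _ => abs_nonneg _)) (abs_nonneg _)) (abs_nonneg _), ?_⟩
  have hAall : ∀ᶠ r in atTop, ∀ a ∈ S,
      circleAverage (fun x => log⁺ ‖F x / (f x - a)‖) 0 r ≤ A a * growthError f r := by
    rw [Filter.eventually_all_finset]
    exact fun a _ => hA a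
  filter_upwards [hAall, hA 0, eventually_ge_atTop (exp 1)] with r hr hr0 hre
  have hrpos : 0 < r := (exp_pos 1).trans_le hre
  have hE := one_le_growthError f hre
  have hgm : ∀ a, Meromorphic (fun x => f x - a) :=
    fun a x => (hf x).sub (MeromorphicAt.const a x)
  have i₁ : ∀ a ∈ S, CircleIntegrable (fun x => log⁺ ‖(f x - a)⁻¹‖) 0 r := fun a _ =>
    (show Meromorphic (fun x => (f x - a)⁻¹) from
      fun x => (hgm a x).inv).meromorphicOn.circleIntegrable_posLog_norm
  have i₂ : ∀ a ∈ S, CircleIntegrable (fun x => log⁺ ‖F x / (f x - a)‖) 0 r := fun a _ =>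
    (show Meromorphic (fun x => F x / (f x - a)) from
      fun x => (hFm x).div (hgm a x)).meromorphicOn.circleIntegrable_posLog_norm
  have i₃ : CircleIntegrable (fun x => log⁺ ‖(F x)⁻¹‖) 0 r :=
    (show Meromorphic (fun x => (F x)⁻¹) from
      fun x => (hFm x).inv).meromorphicOn.circleIntegrable_posLog_norm
  have i₄ : CircleIntegrable (fun x => ∑ a ∈ S, log⁺ ‖F x / (f x - a)‖) 0 r :=
    CircleIntegrable.fun_sum _ i₂
  have i₅ : CircleIntegrable (fun x => ∑ a ∈ S, log⁺ ‖F x / (f x - a)‖ + log⁺ ‖(F x)⁻¹‖) 0 r :=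
    i₄.add i₃
  have hsum : ∑ a ∈ S, proximity f a r ≤
      ∑ a ∈ S, circleAverage (fun x => log⁺ ‖F x / (f x - a)‖) 0 r + proximity F 0 r + C := by
    have h1 : circleAverage (fun x => ∑ a ∈ S, log⁺ ‖(f x - a)⁻¹‖) 0 r ≤ circleAverage (fun x =>
        (∑ a ∈ S, log⁺ ‖F x / (f x - a)‖ + log⁺ ‖(F x)⁻¹‖) + C) 0 r := by
      refine circleAverage_mono_codiscreteWithin hrpos.ne' (CircleIntegrable.fun_sum _ i₁)
        (i₅.add (circleIntegrable_const _ _ _)) ?_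
      filter_upwards [(hFm.meromorphicOn
        (s := sphere 0 |r|)).eventually_codiscreteWithin_apply_ne_zero fun z _ => hFne z] with x hx
      exact hC (f x) (F x) hx
    rw [circleAverage_fun_sum i₁, circleAverage_fun_add i₅ (circleIntegrable_const _ _ _),
      circleAverage_fun_add i₄ i₃, circleAverage_fun_sum i₂, circleAverage_const] at h1
    rw [Finset.sum_congr rfl fun a _ => proximity_coe_eq f a r]
    have h2 := proximity_coe_eq F 0 r
    simp only [sub_zero, WithTop.coe_zero] at h2
    rw [h2]
    exact h1
  -- Jensen's formula trades `m(r, 1/F)` for `m(r, F)` and the counting function of `div F`. Then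
  -- `m(r, F) ≤ m(r, F/f) + m(r, f)`, where the quotient is an error term and `m(r, f) = T(r) - N(r,
  -- f = ∞)`.
  have hJ := characteristic_sub_characteristic_inv_of_ne_zero hFm hrpos.ne'
  have hFf : proximity F ⊤ r ≤ circleAverage (fun x => log⁺ ‖F x / (f x - 0)‖) 0 r
      + proximity f ⊤ r := by
    have h0 : proximity F ⊤ r = proximity ((fun x => F x / (f x - 0)) * f) ⊤ r := by
      refine proximity_congr_codiscrete ?_ hrpos.ne'
      have := (hf.meromorphicOn
        (s := Set.univ)).eventually_codiscreteWithin_apply_ne_zero fun z _ => by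
          simpa using hne 0 z
      filter_upwards [this] with x hx
      simp [hx]
    have h1 := proximity_mul_top_le (f₁ := fun x => F x / (f x - 0)) (f₂ := f)
      (fun x => (hFm x).div (hgm 0 x)) hf r
    rw [h0]
    refine h1.trans (le_of_eq ?_)
    rw [Pi.add_apply, proximity_top]
  have hT : ∑ a ∈ S, (characteristic f ⊤ r - logCounting f a r) ≤
      ∑ a ∈ S, proximity f a r + ∑ a ∈ S, |B a| := by
    rw [← Finset.sum_add_distrib]
    refine Finset.sum_le_sum fun a _ => ?_
    linarith [(abs_le.1 (hB a r)).2, le_abs_self (B a)]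
  have hAsum : ∑ a ∈ S, circleAverage (fun x => log⁺ ‖F x / (f x - a)‖) 0 r ≤
      (∑ a ∈ S, A a) * growthError f r := by
    rw [Finset.sum_mul]
    exact Finset.sum_le_sum fun a ha => hr a ha
  have e1 : characteristic F ⊤ r = proximity F ⊤ r + logCounting F ⊤ r := rfl
  have e2 : characteristic F⁻¹ ⊤ r = proximity F 0 r + logCounting F 0 r := by
    rw [characteristic, Pi.add_apply, proximity_inv, logCounting_inv]
  have e3 : characteristic f ⊤ r = proximity f ⊤ r + logCounting f ⊤ r := rfl
  rw [e1, e2] at hJ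
  have e4 : (MeromorphicOn.divisor F Set.univ).logCounting r =
      logCounting F 0 r - logCounting F ⊤ r := by
    rw [log_counting_zero_sub_logCounting_top, Pi.sub_apply]
  have hLle : -log ‖meromorphicTrailingCoeffAt F 0‖ ≤ L * growthError f r :=
    (neg_le_abs _).trans (le_mul_of_one_le_right (abs_nonneg _) hE)
  have hCle : C ≤ |C| * growthError f r :=
    (le_abs_self _).trans (le_mul_of_one_le_right (abs_nonneg _) hE)
  have hBle : ∑ a ∈ S, |B a| ≤ (∑ a ∈ S, |B a|) * growthError f r :=
    le_mul_of_one_le_right (Finset.sum_nonneg fun a _ => abs_nonneg _) hE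
  rw [e4]
  simp only [add_mul]
  linarith

/-! ### Multiplicities of `a`-points and zeros of the Askey-Wilson difference -/

lemma coe_divisor_univ {g : ℂ → ℂ} (hg : Meromorphic g) {z : ℂ}
    (h : meromorphicOrderAt g z ≠ ⊤) :
    ((MeromorphicOn.divisor g Set.univ z : ℤ) : WithTop ℤ) = meromorphicOrderAt g z := by
  rw [MeromorphicOn.divisor_apply hg.meromorphicOn (Set.mem_univ z), WithTop.coe_untop₀_of_ne_top h]

/-- The divisor of the multiplicities that are not counted by `awDivisor`. -/
noncomputable def awExcess (s : ℂ) (g G : ℂ → ℂ) : Function.locallyFinsupp ℂ ℤ :=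
  (MeromorphicOn.divisor g Set.univ)⁺ - awDivisor s g G

lemma awExcess_apply (s : ℂ) (g G : ℂ → ℂ) (x : ℂ) : awExcess s g G x =
    (min (((MeromorphicOn.divisor g Set.univ)⁺ x : ℤ) : WithTop ℤ)
      (zeroMult G (hat s x))).untop₀ := by
  change (MeromorphicOn.divisor g Set.univ)⁺ x - ((MeromorphicOn.divisor g Set.univ)⁺ x - _) = _
  rw [sub_sub_cancel]

lemma awExcess_nonneg_le (s : ℂ) (g G : ℂ → ℂ) (x : ℂ) :
    0 ≤ awExcess s g G x ∧ awExcess s g G x ≤ (MeromorphicOn.divisor g Set.univ)⁺ x := by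
  rw [awExcess_apply]
  have h1 : 0 ≤ (MeromorphicOn.divisor g Set.univ)⁺ x := posPart_nonneg (_ : ℤ)
  set h := (MeromorphicOn.divisor g Set.univ)⁺ x
  have h2 : (0 : WithTop ℤ) ≤ zeroMult G (hat s x) := le_max_left _ _
  rcases hz : zeroMult G (hat s x) with _ | k
  · rw [WithTop.none_eq_top, min_top_right, WithTop.untop₀_coe]
    exact ⟨h1, le_rfl⟩
  · rw [hz] at h2
    rw [WithTop.some_eq_coe] at h2 ⊢
    have h3 : 0 ≤ k := by exact_mod_cast h2
    rw [← WithTop.coe_min, WithTop.untop₀_coe]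
    exact ⟨le_min h1 h3, min_le_left _ _⟩

lemma awExcess_apply_of_eq {g G : ℂ → ℂ} {x : ℂ} {m : ℤ}
    (hG : meromorphicOrderAt G (hat s x) = m) :
    awExcess s g G x = min (max 0 (MeromorphicOn.divisor g Set.univ x)) (max 0 m) := by
  rw [awExcess_apply, zeroMult, hG, ← WithTop.coe_zero, ← WithTop.coe_max, ← WithTop.coe_min,
    WithTop.untop₀_coe, Function.locallyFinsuppWithin.posPart_apply, posPart_def, sup_comm]

lemma divisor_sub_const_eq_zero {a b x : ℂ} (hf : Meromorphic f)
    (hne : ∀ a z, meromorphicOrderAt (fun x => f x - a) z ≠ ⊤) (hab : a ≠ b)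
    (ha : 0 < MeromorphicOn.divisor (fun x => f x - a) Set.univ x) :
    MeromorphicOn.divisor (fun x => f x - b) Set.univ x = 0 := by
  have hgm : ∀ a, Meromorphic (fun x => f x - a) :=
    fun a x => (hf x).sub (MeromorphicAt.const a x)
  have h1 := coe_divisor_univ (hgm a) (hne a x)
  have h2 := coe_divisor_univ (hgm b) (hne b x)
  have h3 : (fun x => f x - b) = (fun _ => a - b) + (fun x => f x - a) := by
    ext x; simp
  have h4 : meromorphicOrderAt (fun _ : ℂ => a - b) x = 0 := by
    classical
    rw [meromorphicOrderAt_const, if_neg (sub_ne_zero.2 hab)]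
  have h5 := meromorphicOrderAt_add_eq_left_of_lt (f₁ := fun _ => a - b) (hgm a x) (by
    rw [h4, ← h1]; exact_mod_cast ha)
  rw [← h3, h4, ← h2] at h5
  exact_mod_cast h5

lemma divisor_nonneg_of_pos {a x : ℂ} (hf : Meromorphic f)
    (hne : ∀ a z, meromorphicOrderAt (fun x => f x - a) z ≠ ⊤)
    (ha : 0 < MeromorphicOn.divisor (fun x => f x - a) Set.univ x) :
    0 ≤ MeromorphicOn.divisor f Set.univ x := by
  rcases eq_or_ne a 0 with rfl | h
  · simpa using ha.le
  · simpa using (divisor_sub_const_eq_zero hf hne h ha).ge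

/-- A point is an `a`-point for at most one finite `a`, so at most one summand is nonzero, and it is
at most the multiplicity of the zero of `F` at `x̂`. The second alternative also records that `x` is
then not a pole of `f`, which excludes a simultaneous contribution at infinity. -/
lemma sum_awExcess_le {x : ℂ} {d : ℤ} (hf : Meromorphic f)
    (hne : ∀ a z, meromorphicOrderAt (fun x => f x - a) z ≠ ⊤) {F : ℂ → ℂ}
    (hF : meromorphicOrderAt F (hat s x) = d) (S : Finset ℂ) :
    ∑ a ∈ S, awExcess s (fun x => f x - a) F x ≤ 0 ∨
      (0 ≤ MeromorphicOn.divisor f Set.univ x ∧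
        ∑ a ∈ S, awExcess s (fun x => f x - a) F x ≤ max 0 d) := by
  by_cases hex : ∃ a ∈ S, 0 < MeromorphicOn.divisor (fun x => f x - a) Set.univ x
  · obtain ⟨a, haS, ha⟩ := hex
    refine Or.inr ⟨divisor_nonneg_of_pos hf hne ha, ?_⟩
    rw [Finset.sum_eq_single_of_mem a haS]
    · rw [awExcess_apply_of_eq hF]
      exact min_le_right _ _
    · intro b _ hba
      rw [awExcess_apply_of_eq hF, divisor_sub_const_eq_zero hf hne hba.symm ha]
      simp
  · push Not at hex
    refine Or.inl (Finset.sum_nonpos fun a ha => ?_)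
    rw [awExcess_apply_of_eq hF, max_eq_left (hex a ha)]
    exact min_le_left _ _

/-- Outside of a disc the uncounted multiplicities are controlled by the divisor of `D_q f` and the
poles of `f`. -/
lemma exists_sum_awExcess_le (hs : s ≠ 0) (hs1 : ‖s‖ < 1) (hf : Meromorphic f)
    (hne : ∀ a z, meromorphicOrderAt (fun x => f x - a) z ≠ ⊤)
    (hD : ¬ awOp s f =ᶠ[codiscrete ℂ] fun _ => 0) (S : Finset ℂ) {M : ℝ} (hM : 1 ≤ M)
    (hhat : ∀ x : ℂ, M < ‖x‖ → 1 < ‖hat s x‖) (hcheck : ∀ x : ℂ, M < ‖x‖ → 1 < ‖check s x‖)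
    (hW : ∀ x : ℂ, M < ‖x‖ → 1 ≤ ‖hat s x - check s x‖)
    (hinv : ∀ x : ℂ, M < ‖x‖ → ‖s‖⁻¹ + 1 < 2 * ‖x‖) {y : ℂ} (hy : M < ‖y‖) :
    (∑ a ∈ S, awExcess s (fun x => f x - a) (awOp s f) +
      awExcess s (fun x => (f x)⁻¹) (awOp s fun x => (f x)⁻¹)) (check s y) ≤
      MeromorphicOn.divisor (awOp s f) Set.univ y +
        (MeromorphicOn.divisor f Set.univ)⁻ (check s y) +
        (MeromorphicOn.divisor f Set.univ)⁻ (hat s y) := by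
  set F := awOp s f with hF
  have hFm : Meromorphic F := meromorphic_awOp hf
  have hFne := hFm.meromorphicOrderAt_ne_top hD
  have hne0 : ∀ z, meromorphicOrderAt f z ≠ ⊤ := by simpa using hne 0
  have hy1 : 1 < ‖y‖ := hM.trans_lt hy
  set α := MeromorphicOn.divisor f Set.univ (check s y) with hα
  set β := MeromorphicOn.divisor f Set.univ (hat s y) with hβ
  set d := MeromorphicOn.divisor F Set.univ y with hd
  have ehat : hat s (check s y) = y := hat_check hs hs1 y
  have ed : meromorphicOrderAt F y = d := (coe_divisor_univ hFm (hFne y)).symm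
  have an1 : AnalyticAt ℂ (hat s) y := analyticAt_hat hy1
  have an2 : AnalyticAt ℂ (check s) y := analyticAt_check hy1
  have eα : meromorphicOrderAt (f ∘ check s) y = α := by
    rw [meromorphicOrderAt_comp_of_deriv_ne_zero an2
      (deriv_check_ne_zero hs hs1 hy1 (hcheck y hy)), ← coe_divisor_univ hf (hne0 _)]
  have eβ : meromorphicOrderAt (f ∘ hat s) y = β := by
    rw [meromorphicOrderAt_comp_of_deriv_ne_zero an1
      (deriv_hat_ne_zero hs hy1 (hinv y hy) (hhat y hy)), ← coe_divisor_univ hf (hne0 _)]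
  have mA : MeromorphicAt (f ∘ check s) y := (hf _).comp_analyticAt an2
  have mB : MeromorphicAt (f ∘ hat s) y := (hf _).comp_analyticAt an1
  have anW : AnalyticAt ℂ (fun x => hat s x - check s x) y := an1.sub an2
  have hnhds : ∀ᶠ x in 𝓝[≠] y, M < ‖x‖ :=
    (continuous_norm.continuousAt.eventually_const_lt hy).filter_mono nhdsWithin_le_nhds
  have hmain : ∀ x : ℂ, M < ‖x‖ → x ≠ 1 ∧ x ≠ -1 ∧ hat s x - check s x ≠ 0 := by
    intro x hx
    refine ⟨?_, ?_, ?_⟩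
    · rintro rfl; simp at hx; linarith
    · rintro rfl; simp at hx; linarith
    · intro h0
      have := hW x hx
      rw [h0, norm_zero] at this
      linarith
  have eW : meromorphicOrderAt (fun x => hat s x - check s x) y = 0 := by
    rw [anW.meromorphicOrderAt_eq, anW.analyticOrderAt_eq_zero.2 (hmain y hy).2.2]
    rfl
  -- the difference of the values is comparable with `F`
  have eF : meromorphicOrderAt (f ∘ hat s + -(f ∘ check s)) y = d := by
    have h1 : (f ∘ hat s + -(f ∘ check s)) =ᶠ[𝓝[≠] y] F * fun x => hat s x - check s x := by
      filter_upwards [hnhds] with x hx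
      obtain ⟨n1, n2, n3⟩ := hmain x hx
      simp only [Pi.add_apply, Pi.neg_apply, Function.comp_apply, Pi.mul_apply, hF, awOp]
      rw [if_neg (by tauto), div_mul_cancel₀ _ n3, sub_eq_add_neg]
    rw [meromorphicOrderAt_congr h1, meromorphicOrderAt_mul (hFm y) anW.meromorphicAt, eW, ed,
      add_zero]
  have hmin : min α β ≤ d := by
    have h1 := meromorphicOrderAt_add mB mA.neg
    rw [eF, ← meromorphicOrderAt_neg, eα, eβ, ← WithTop.coe_min] at h1
    rw [min_comm]
    exact_mod_cast h1
  -- Since `D_q (1/f) = -D_q f / (f(x̂) f(x̌))`, its order is determined by those of `F` and of the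
  -- two shifted functions.
  have eG : meromorphicOrderAt (awOp s fun x => (f x)⁻¹) y = ((d - α - β : ℤ) : WithTop ℤ) := by
    have nA : ∀ᶠ x in 𝓝[≠] y, (f ∘ check s) x ≠ 0 :=
      (meromorphicOrderAt_ne_top_iff_eventually_ne_zero mA).1 (by rw [eα]; exact WithTop.coe_ne_top)
    have nB : ∀ᶠ x in 𝓝[≠] y, (f ∘ hat s) x ≠ 0 :=
      (meromorphicOrderAt_ne_top_iff_eventually_ne_zero mB).1 (by rw [eβ]; exact WithTop.coe_ne_top)
    have h1 : (awOp s fun x => (f x)⁻¹) =ᶠ[𝓝[≠] y]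
        (-F) * ((f ∘ check s)⁻¹ * (f ∘ hat s)⁻¹) := by
      filter_upwards [hnhds, nA, nB] with x hx hA hB
      obtain ⟨n1, n2, n3⟩ := hmain x hx
      simp only [Function.comp_apply] at hA hB
      simp only [Pi.neg_apply, Function.comp_apply, Pi.mul_apply, Pi.inv_apply, hF, awOp]
      rw [if_neg (by tauto), if_neg (by tauto)]
      field_simp
      ring
    rw [meromorphicOrderAt_congr h1, meromorphicOrderAt_mul (hFm y).neg (mA.inv.mul mB.inv),
      meromorphicOrderAt_mul mA.inv mB.inv, meromorphicOrderAt_inv, meromorphicOrderAt_inv,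
      ← meromorphicOrderAt_neg, ed, eα, eβ]
    have : d - α - β = d + (-α + -β) := by ring
    rw [this]
    rfl
  have hinf : awExcess s (fun x => (f x)⁻¹) (awOp s fun x => (f x)⁻¹) (check s y) =
      min (max 0 (-α)) (max 0 (d - α - β)) := by
    rw [awExcess_apply_of_eq (m := d - α - β) (by rw [ehat]; exact eG),
      MeromorphicOn.divisor_fun_inv]
    rfl
  have hsum := sum_awExcess_le (s := s) (x := check s y) hf hne (by rw [ehat]; exact ed) S
  rw [Function.locallyFinsuppWithin.coe_add, Pi.add_apply, Function.locallyFinsuppWithin.coe_sum,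
    Finset.sum_apply, hinf, Function.locallyFinsuppWithin.negPart_apply,
    Function.locallyFinsuppWithin.negPart_apply, negPart_def, negPart_def, ← hα, ← hβ]
  change _ ≤ d + max (-α) 0 + max (-β) 0
  rw [← hα] at hsum
  -- If `α ≥ 0`, the excess at infinity vanishes, and when `d < 0` the bound `hmin` forces `β ≤ d`,
  -- so the pole at `ŷ` compensates. If `α < 0`, the finite values contribute nothing; `d - α - β`
  -- is within the bound, and `hmin` makes the right side nonnegative.
  omega

/-- The counting function of the uncounted multiplicities. -/
lemma exists_logCounting_awExcess_le (hs : s ≠ 0) (hs1 : ‖s‖ < 1) (hf : Meromorphic f)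
    (hne : ∀ a z, meromorphicOrderAt (fun x => f x - a) z ≠ ⊤)
    (hD : ¬ awOp s f =ᶠ[codiscrete ℂ] fun _ => 0) (S : Finset ℂ) :
    ∃ A, 0 ≤ A ∧ ∀ᶠ r in atTop, (∑ a ∈ S, awExcess s (fun x => f x - a) (awOp s f) +
      awExcess s (fun x => (f x)⁻¹) (awOp s fun x => (f x)⁻¹)).logCounting r ≤
      (MeromorphicOn.divisor (awOp s f) Set.univ).logCounting r + 2 * logCounting f ⊤ r +
        A * growthError f r := by
  obtain ⟨M, K, C, hσ, hτ, hle, hch, hhat, hcheck, hW, hinv⟩ := exists_isShift hs hs1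
  have hM := hσ.one_le_radius
  have hK := hσ.one_le_factor
  have hM0 : 0 ≤ M := by linarith
  have hs0 : 0 < ‖s‖ := norm_pos_iff.2 hs
  set k := ∑ a ∈ S, awExcess s (fun x => f x - a) (awOp s f) +
      awExcess s (fun x => (f x)⁻¹) (awOp s fun x => (f x)⁻¹) with hk
  have hk0 : 0 ≤ k := by
    have : ∀ g G, 0 ≤ awExcess s g G := fun g G x => (awExcess_nonneg_le s g G x).1
    exact add_nonneg (Finset.sum_nonneg fun a _ => this _ _) (this _ _)
  set P := (MeromorphicOn.divisor f Set.univ)⁻ with hP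
  have hP0 : 0 ≤ P := negPart_nonneg _
  have nz : ∀ {σ : ℂ → ℂ}, (∀ x : ℂ, M < ‖x‖ → 1 < ‖σ x‖) → ∀ y : ℂ, M < ‖y‖ → σ y ≠ 0 := by
    intro σ h y hy h0
    have := h y hy
    rw [h0, norm_zero] at this
    linarith
  -- The excess is attached to `x`, but the zeros of `D_q f` it refers to lie at `x̂`; `E` moves it
  -- there. Because `|x̂| ≤ |x|` far out, moving back costs no enlargement of the radius, so `div F`
  -- appears at `r` itself, as its cancellation requires. Only the pole terms are counted at `K r`.
  set E := shiftDivisor k (check s) M K hτ.injOn hτ.norm_le (zero_le_one.trans hK) with hE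
  have hE0 : 0 ≤ E := shiftDivisor_nonneg hk0 _ _ _
  have hle1 : ∀ x : ℂ, M < ‖x‖ → ‖hat s x‖ ≤ 1 * ‖x‖ := fun x hx => by
    rw [one_mul]; exact hle x hx
  obtain ⟨C₁, h₁⟩ := exists_logCounting_le_add (D := k)
    (E := shiftDivisor E (hat s) M 1 hσ.injOn hle1 zero_le_one)
    (M := (M + (‖s‖ + ‖s‖⁻¹) / 2) / ‖s‖ + M) (by
      intro x hx
      have hx1 : M < ‖x‖ := by
        have : 0 ≤ (M + (‖s‖ + ‖s‖⁻¹) / 2) / ‖s‖ := by positivity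
        linarith
      have hx2 : M < ‖hat s x‖ := by
        have h := le_norm_hat s x
        have : M + (‖s‖ + ‖s‖⁻¹) / 2 < ‖s‖ * ‖x‖ := by
          rw [← div_lt_iff₀' hs0]; linarith
        linarith
      rw [shiftDivisor_apply, if_pos hx1, hE, shiftDivisor_apply, if_pos hx2, hch x hx1])
  obtain ⟨C₂, h₂⟩ := exists_logCounting_le_add (D := E)
    (E := MeromorphicOn.divisor (awOp s f) Set.univ +
      shiftDivisor P (check s) M K hτ.injOn hτ.norm_le (zero_le_one.trans hK) +
      shiftDivisor P (hat s) M K hσ.injOn hσ.norm_le (zero_le_one.trans hK)) (M := M) (by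
      intro y hy
      have := exists_sum_awExcess_le hs hs1 hf hne hD S hM hhat hcheck hW hinv hy
      simp only [Function.locallyFinsuppWithin.coe_add, Pi.add_apply, shiftDivisor_apply, hE,
        if_pos hy]
      exact this)
  refine ⟨|C₁| + |C₂| + 2 * log K, by have := log_nonneg hK; positivity, ?_⟩
  filter_upwards [h₁, h₂, eventually_gt_atTop 1, eventually_ge_atTop K] with r hr₁ hr₂ hr1 hrK
  have e1 := logCounting_shiftDivisor_le hE0 hσ.injOn hle1 hM0 (nz hhat) le_rfl hr1.le
  have e2 := logCounting_shiftDivisor_le hP0 hσ.injOn hσ.norm_le hM0 (nz hhat) hK hr1.le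
  have e3 := logCounting_shiftDivisor_le hP0 hτ.injOn hτ.norm_le hM0 (nz hcheck) hK hr1.le
  have e4 := logCounting_mul_le hP0 hr1 hK hrK
  rw [one_mul] at e1
  rw [map_add, map_add, Pi.add_apply, Pi.add_apply] at hr₂
  have hlog := log_pos hr1
  have hPf : P.logCounting = logCounting f ⊤ := logCounting_top.symm
  have e5 : P.logCounting (r ^ 4) / log r ≤ growthError f r := by
    refine le_trans ?_ (div_log_le_growthError f hr1.le)
    have h : characteristic f ⊤ (r ^ 4) = proximity f ⊤ (r ^ 4) + logCounting f ⊤ (r ^ 4) := rfl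
    have h' := proximity_nonneg (f := f) (a := ⊤) (r ^ 4)
    simp only [Pi.zero_apply] at h'
    rw [hPf]
    gcongr
    linarith
  have e6 := mul_le_mul_of_nonneg_left e5 (log_nonneg hK)
  have e7 := log_le_growthError f hr1.le
  have e8 : ∀ C : ℝ, C * log r ≤ |C| * growthError f r := fun C =>
    (mul_le_mul_of_nonneg_right (le_abs_self C) hlog.le).trans
      (mul_le_mul_of_nonneg_left e7 (abs_nonneg C))
  have e9 := e8 C₁
  have e10 := e8 C₂
  rw [hPf] at e2 e3 e4
  rw [hPf] at e6
  simp only [add_mul]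
  linarith

/-- The second main theorem for the Askey-Wilson operator. -/
theorem exists_sum_characteristic_sub_awLogCounting_le (hs : s ≠ 0) (hs1 : ‖s‖ < 1)
    (hf : Meromorphic f) (hne : ∀ a z, meromorphicOrderAt (fun x => f x - a) z ≠ ⊤)
    (hD : ¬ awOp s f =ᶠ[codiscrete ℂ] fun _ => 0) (S : Finset ℂ) :
    ∃ A, 0 ≤ A ∧ ∀ᶠ r in atTop,
      ∑ a ∈ S, (characteristic f ⊤ r - awLogCounting s f (a : WithTop ℂ) r) +
        (characteristic f ⊤ r - awLogCounting s f ⊤ r) ≤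
        2 * characteristic f ⊤ r + A * growthError f r := by
  obtain ⟨A, hA, h₁⟩ := exists_sum_characteristic_sub_logCounting_le hs hs1 hf hne hD S
  obtain ⟨B, hB, h₂⟩ := exists_logCounting_awExcess_le hs hs1 hf hne hD S
  refine ⟨A + B, by positivity, ?_⟩
  filter_upwards [h₁, h₂] with r hr₁ hr₂
  have e1 : ∀ a : ℂ, (awExcess s (fun x => f x - a) (awOp s f)).logCounting r =
      logCounting f a r - awLogCounting s f (a : WithTop ℂ) r := by
    intro a
    rw [awExcess, map_sub, Pi.sub_apply, logCounting_coe]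
    rfl
  have e2 : (awExcess s (fun x => (f x)⁻¹) (awOp s fun x => (f x)⁻¹)).logCounting r =
      logCounting f ⊤ r - awLogCounting s f ⊤ r := by
    rw [awExcess, map_sub, Pi.sub_apply, MeromorphicOn.divisor_fun_inv, posPart_neg, logCounting_top]
    rfl
  rw [map_add, Pi.add_apply, e2, map_sum, Finset.sum_apply, Finset.sum_congr rfl fun a _ => e1 a,
    Finset.sum_sub_distrib] at hr₂
  rw [Finset.sum_sub_distrib] at hr₁ ⊢
  rw [add_mul]
  linarith

end AskeyWilson

namespace AskeyWilson

open Real ValueDistribution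

/-! ### Deficiencies -/

section Deficiency

variable {T N N' : ℝ → ℝ} {C : ℝ}

lemma eventually_div_le (hT : Tendsto T atTop atTop) (hN : ∀ᶠ r in atTop, N r ≤ T r + C) {ε : ℝ}
    (hε : 0 < ε) : ∀ᶠ r in atTop, N r / T r ≤ 1 + ε := by
  filter_upwards [hN, hT.eventually_gt_atTop 0, hT.eventually_ge_atTop (C / ε)] with r h1 h2 h3
  rw [div_le_iff₀ hε] at h3
  rw [div_le_iff₀ h2]
  linarith

lemma eventually_div_nonneg (hT : Tendsto T atTop atTop) (h0 : ∀ᶠ r in atTop, 0 ≤ N r) :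
    ∀ᶠ r in atTop, 0 ≤ N r / T r := by
  filter_upwards [h0, hT.eventually_gt_atTop 0] with r h1 h2
  positivity

lemma isBoundedUnder_le_div (hT : Tendsto T atTop atTop) (hN : ∀ᶠ r in atTop, N r ≤ T r + C) :
    IsBoundedUnder (· ≤ ·) atTop fun r => N r / T r :=
  isBoundedUnder_of_eventually_le (eventually_div_le hT hN one_pos)

lemma isBoundedUnder_ge_div (hT : Tendsto T atTop atTop) (h0 : ∀ᶠ r in atTop, 0 ≤ N r) :
    IsBoundedUnder (· ≥ ·) atTop fun r => N r / T r :=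
  isBoundedUnder_of_eventually_ge (eventually_div_nonneg hT h0)

lemma limsup_div_le_one (hT : Tendsto T atTop atTop) (h0 : ∀ᶠ r in atTop, 0 ≤ N r)
    (hN : ∀ᶠ r in atTop, N r ≤ T r + C) : limsup (fun r => N r / T r) atTop ≤ 1 :=
  le_of_forall_pos_le_add fun _ hε => limsup_le_of_le
    (isBoundedUnder_ge_div hT h0).isCoboundedUnder_le (eventually_div_le hT hN hε)

lemma liminf_sub_div_nonneg (hT : Tendsto T atTop atTop) (h0 : ∀ᶠ r in atTop, 0 ≤ N' r)
    (hle : ∀ᶠ r in atTop, N' r ≤ N r) (hN : ∀ᶠ r in atTop, N r ≤ T r + C) :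
    0 ≤ liminf (fun r => (N r - N' r) / T r) atTop := by
  have h1 : ∀ᶠ r in atTop, N r - N' r ≤ T r + C := by
    filter_upwards [h0, hN] with r h2 h3
    linarith
  refine le_liminf_of_le (isBoundedUnder_le_div hT h1).isCoboundedUnder_ge
    (eventually_div_nonneg hT ?_)
  filter_upwards [hle] with r h2
  linarith

/-- This is `limsup u + liminf v ≤ limsup (u + v)`; it yields `δ + ϑ_AW ≤ Θ_AW` for each single
value. -/
lemma limsup_add_liminf_sub_le (hT : Tendsto T atTop atTop) (h0 : ∀ᶠ r in atTop, 0 ≤ N' r)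
    (hle : ∀ᶠ r in atTop, N' r ≤ N r) (hN : ∀ᶠ r in atTop, N r ≤ T r + C) :
    limsup (fun r => N' r / T r) atTop + liminf (fun r => (N r - N' r) / T r) atTop ≤
      limsup (fun r => N r / T r) atTop := by
  have h1 : ∀ᶠ r in atTop, N r - N' r ≤ T r + C := by
    filter_upwards [h0, hN] with r h2 h3
    linarith
  have h1' : ∀ᶠ r in atTop, 0 ≤ N r - N' r := by
    filter_upwards [hle] with r h2
    linarith
  have h2 : ∀ᶠ r in atTop, N' r ≤ T r + C := by
    filter_upwards [hle, hN] with r h2 h3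
    linarith
  refine (le_limsup_add (isBoundedUnder_le_div hT h2)
    (isBoundedUnder_ge_div hT h0).isCoboundedUnder_le (isBoundedUnder_le_div hT h1)
    (isBoundedUnder_ge_div hT h1')).trans (le_of_eq ?_)
  congr 1
  ext r
  simp only [Pi.add_apply]
  ring

/-- If the defects `T - N a` sum to at most `2 T + o(T)` along a sequence, then the deficiencies
sum to at most `2`. -/
lemma sum_one_sub_limsup_le_two {ι : Type*} {N : ι → ℝ → ℝ} {C : ι → ℝ}
    (hT : Tendsto T atTop atTop) (hN : ∀ a, ∀ᶠ r in atTop, N a r ≤ T r + C a) (U : Finset ι)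
    (h : ∀ ε > 0, ∃ᶠ r in atTop, ∑ a ∈ U, (T r - N a r) ≤ 2 * T r + ε * T r) :
    ∑ a ∈ U, (1 - limsup (fun r => N a r / T r) atTop) ≤ 2 := by
  set L : ι → ℝ := fun a => limsup (fun r => N a r / T r) atTop with hL
  have key : ∀ ε > 0, ∑ a ∈ U, (1 - L a) ≤ 2 + ε * (U.card + 1) := by
    intro ε hε
    have hev : ∀ᶠ r in atTop, ∀ a ∈ U, N a r / T r < L a + ε := by
      rw [Filter.eventually_all_finset]
      exact fun a _ => eventually_lt_of_limsup_lt (lt_add_of_pos_right _ hε)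
        (isBoundedUnder_le_div hT (hN a))
    -- The bounds coming from the `limsup` hold for all large `r`, so the hypothesis on the sum is
    -- needed at a single large radius only.
    obtain ⟨r, hr, hr1, hr2⟩ := ((h ε hε).and_eventually
      (hev.and (hT.eventually_gt_atTop 0))).exists
    have h1 : (∑ a ∈ U, (1 - L a - ε)) * T r ≤ ∑ a ∈ U, (T r - N a r) := by
      rw [Finset.sum_mul]
      refine Finset.sum_le_sum fun a ha => ?_
      have := hr1 a ha
      rw [div_lt_iff₀ hr2] at this
      linarith
    have h2 : (∑ a ∈ U, (1 - L a - ε)) * T r ≤ (2 + ε) * T r := by linarith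
    have h3 := le_of_mul_le_mul_right h2 hr2
    rw [Finset.sum_sub_distrib, Finset.sum_const, nsmul_eq_mul] at h3
    linarith
  refine le_of_forall_pos_le_add fun ε hε => ?_
  have hc : (0 : ℝ) < U.card + 1 := by positivity
  have := key (ε / (U.card + 1)) (by positivity)
  rwa [div_mul_cancel₀ _ hc.ne'] at this

end Deficiency

/-! ### Transcendental functions of finite logarithmic order -/

variable {s : ℂ} {f : ℂ → ℂ}

lemma IsTranscendental.tendsto_characteristic (hf : Meromorphic f) (htr : IsTranscendental f) :
    Tendsto (characteristic f ⊤) atTop atTop := by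
  refine tendsto_atTop_mono' _ (htr.eventually_mul_log_le hf 1) ?_
  simpa using tendsto_log_atTop

lemma exists_logCounting_le_characteristic (hf : Meromorphic f) (a : WithTop ℂ) :
    ∃ C, ∀ᶠ r in atTop, logCounting f a r ≤ characteristic f ⊤ r + C := by
  induction a using WithTop.recTopCoe with
  | top =>
    refine ⟨0, Eventually.of_forall fun r => ?_⟩
    have h := proximity_nonneg (f := f) (a := ⊤) r
    simp only [Pi.zero_apply] at h
    have e : characteristic f ⊤ r = proximity f ⊤ r + logCounting f ⊤ r := rfl
    linarith
  | coe a =>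
    obtain ⟨C, hC⟩ := exists_abs_characteristic_sub_le hf a
    refine ⟨C, Eventually.of_forall fun r => ?_⟩
    have h := proximity_nonneg (f := f) (a := (a : WithTop ℂ)) r
    simp only [Pi.zero_apply] at h
    linarith [(abs_le.1 (hC r)).1]

lemma awDivisor_nonneg (s : ℂ) (g G : ℂ → ℂ) : 0 ≤ awDivisor s g G := by
  intro x
  have h := (awExcess_nonneg_le s g G x).2
  have e : awExcess s g G x = (MeromorphicOn.divisor g Set.univ)⁺ x - awDivisor s g G x := rfl
  rw [e] at h
  change 0 ≤ awDivisor s g G x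
  linarith

lemma awDivisor_le (s : ℂ) (g G : ℂ → ℂ) : awDivisor s g G ≤ (MeromorphicOn.divisor g Set.univ)⁺ := by
  intro x
  have h := (awExcess_nonneg_le s g G x).1
  have e : awExcess s g G x = (MeromorphicOn.divisor g Set.univ)⁺ x - awDivisor s g G x := rfl
  rw [e] at h
  change awDivisor s g G x ≤ (MeromorphicOn.divisor g Set.univ)⁺ x
  linarith

lemma awLogCounting_nonneg (s : ℂ) (f : ℂ → ℂ) (a : WithTop ℂ) {r : ℝ} (hr : 1 ≤ r) :
    0 ≤ awLogCounting s f a r := by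
  induction a using WithTop.recTopCoe with
  | top => exact Function.locallyFinsuppWithin.logCounting_nonneg (awDivisor_nonneg _ _ _) hr
  | coe a => exact Function.locallyFinsuppWithin.logCounting_nonneg (awDivisor_nonneg _ _ _) hr

lemma awLogCounting_le (s : ℂ) (f : ℂ → ℂ) (a : WithTop ℂ) {r : ℝ} (hr : 1 ≤ r) :
    awLogCounting s f a r ≤ logCounting f a r := by
  induction a using WithTop.recTopCoe with
  | top =>
    have h := Function.locallyFinsuppWithin.logCounting_le
      (awDivisor_le s (fun x => (f x)⁻¹) (awOp s fun x => (f x)⁻¹)) hr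
    rwa [MeromorphicOn.divisor_fun_inv, posPart_neg, ← logCounting_top] at h
  | coe a =>
    have h := Function.locallyFinsuppWithin.logCounting_le
      (awDivisor_le s (fun x => f x - a) (awOp s f)) hr
    rwa [← logCounting_coe] at h

/-- Along a sequence of radii the error term is small compared with the characteristic. -/
lemma IsTranscendental.frequently_growthError_le (hf : Meromorphic f) (htr : IsTranscendental f)
    (hord : logOrder f < ⊤) {ε : ℝ} (hε : 0 < ε) :
    ∃ᶠ r in atTop, growthError f r ≤ ε * characteristic f ⊤ r := by
  obtain ⟨C, hC, hfr⟩ := exists_frequently_pow_four_le hord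
    (by simpa using htr.eventually_mul_log_le hf 1)
  -- The error consists of `log r`, `1 / log r` and `T(r⁴) / log r`; each is made at most `ε / 3`
  -- times the characteristic.
  refine (hfr.and_eventually ((htr.eventually_mul_log_le hf (3 / ε)).and
    ((htr.tendsto_characteristic hf).eventually_ge_atTop (3 / ε) |>.and
    ((tendsto_log_atTop.eventually_ge_atTop 1).and
    (tendsto_log_atTop.eventually_ge_atTop (3 * C / ε)))))).mono ?_
  rintro r ⟨h4, hlog, hT, hlog1, hlogC⟩
  have hlog0 : 0 < log r := by linarith
  rw [div_mul_eq_mul_div, div_le_iff₀ hε] at hlog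
  rw [div_le_iff₀ hε] at hT hlogC
  have hT0 : 0 < characteristic f ⊤ r := by nlinarith
  have h5 : (1 + characteristic f ⊤ (r ^ 4)) / log r ≤ 2 * ε / 3 * characteristic f ⊤ r := by
    rw [div_le_iff₀ hlog0]
    have h6 : 3 * C * characteristic f ⊤ r ≤ log r * ε * characteristic f ⊤ r :=
      mul_le_mul_of_nonneg_right hlogC hT0.le
    have h7 : characteristic f ⊤ r * ε ≤ characteristic f ⊤ r * ε * log r :=
      le_mul_of_one_le_right (by positivity) hlog1
    linarith
  unfold growthError
  linarith

lemma sum_insert_top_image_coe (g : WithTop ℂ → ℝ) (S : Finset ℂ) :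
    ∑ a ∈ insert ⊤ (S.image ((↑) : ℂ → WithTop ℂ)), g a = ∑ a ∈ S, g a + g ⊤ := by
  rw [Finset.sum_insert (by simp), Finset.sum_image fun a _ b _ h => WithTop.coe_injective h,
    add_comm]

theorem sum_awDeficiency_le_two (hs : s ≠ 0) (hs1 : ‖s‖ < 1) (hf : Meromorphic f)
    (htr : IsTranscendental f) (hord : logOrder f < ⊤)
    (hD : ¬ awOp s f =ᶠ[codiscrete ℂ] fun _ => 0) (S : Finset ℂ) :
    ∑ a ∈ S, awDeficiency s f (a : WithTop ℂ) + awDeficiency s f ⊤ ≤ 2 := by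
  classical
  have hT := htr.tendsto_characteristic hf
  choose C hC using exists_logCounting_le_characteristic hf
  have hN : ∀ a, ∀ᶠ r in atTop, awLogCounting s f a r ≤ characteristic f ⊤ r + C a := by
    intro a
    filter_upwards [hC a, eventually_ge_atTop 1] with r h1 h2
    exact (awLogCounting_le s f a h2).trans h1
  obtain ⟨A, hA, hev⟩ := exists_sum_characteristic_sub_awLogCounting_le hs hs1 hf
    (htr.meromorphicOrderAt_sub_ne_top hf) hD S
  have hsum := fun g => sum_insert_top_image_coe g S
  have h := sum_one_sub_limsup_le_two hT hN (insert ⊤ (S.image (↑))) (fun ε hε => by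
    refine ((htr.frequently_growthError_le hf hord (ε := ε / (A + 1))
      (by positivity)).and_eventually (hev.and (hT.eventually_gt_atTop 0))).mono ?_
    rintro r ⟨h1, h2, h3⟩
    rw [hsum fun a => characteristic f ⊤ r - awLogCounting s f a r]
    refine h2.trans (add_le_add le_rfl ?_)
    refine (mul_le_mul_of_nonneg_left h1 hA).trans ?_
    rw [← mul_assoc]
    refine mul_le_mul_of_nonneg_right ?_ h3.le
    rw [mul_div_assoc', div_le_iff₀ (by positivity)]
    nlinarith)
  exact (hsum fun a => awDeficiency s f a).symm.le.trans h

end AskeyWilson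

/-! ### The defect relation -/

theorem theoremT (q s : ℂ) (hs : s ^ 2 = q) (hq0 : 0 < ‖q‖) (hq1 : ‖q‖ < 1)
    (f : ℂ → ℂ) (hf : Meromorphic f) (htr : AskeyWilson.IsTranscendental f)
    (hord : AskeyWilson.logOrder f < ⊤)
    (hD : ¬ AskeyWilson.awOp s f =ᶠ[codiscrete ℂ] fun _ => 0) :
    Summable (fun a : WithTop ℂ =>
      AskeyWilson.deficiency f a + AskeyWilson.awMultIndex s f a) ∧
    Summable (fun a : WithTop ℂ => AskeyWilson.awDeficiency s f a) ∧
    ∑' a : WithTop ℂ, (AskeyWilson.deficiency f a + AskeyWilson.awMultIndex s f a) ≤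
      ∑' a : WithTop ℂ, AskeyWilson.awDeficiency s f a ∧
    ∑' a : WithTop ℂ, AskeyWilson.awDeficiency s f a ≤ 2 ∧
    {a : WithTop ℂ | 0 < AskeyWilson.awDeficiency s f a}.Countable := by
  open AskeyWilson ValueDistribution in
  have hs0 : s ≠ 0 := by
    rintro rfl
    rw [← hs] at hq0
    simp at hq0
  have hs1 : ‖s‖ < 1 := by
    rw [← hs, norm_pow] at hq1
    exact (pow_lt_one_iff_of_nonneg (norm_nonneg s) two_ne_zero).1 hq1
  have hT := htr.tendsto_characteristic hf
  choose C hC using exists_logCounting_le_characteristic hf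
  have h0 : ∀ a, ∀ᶠ r in atTop, 0 ≤ awLogCounting s f a r := fun a => by
    filter_upwards [eventually_ge_atTop 1] with r hr using awLogCounting_nonneg s f a hr
  have hle : ∀ a, ∀ᶠ r in atTop, awLogCounting s f a r ≤ logCounting f a r := fun a => by
    filter_upwards [eventually_ge_atTop 1] with r hr using awLogCounting_le s f a hr
  have hN0 : ∀ a, ∀ᶠ r in atTop, 0 ≤ logCounting f a r := fun a => by
    filter_upwards [eventually_ge_atTop 1] with r hr using logCounting_nonneg hr
  have hΘ : ∀ a, 0 ≤ awDeficiency s f a := fun a => sub_nonneg.2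
    (limsup_div_le_one hT (h0 a) ((hle a).mp ((hC a).mono fun _ h1 h2 => h2.trans h1)))
  have hδ : ∀ a, 0 ≤ deficiency f a + awMultIndex s f a := fun a => add_nonneg
    (sub_nonneg.2 (limsup_div_le_one hT (hN0 a) (hC a)))
    (liminf_sub_div_nonneg hT (h0 a) (hle a) (hC a))
  have hδΘ : ∀ a, deficiency f a + awMultIndex s f a ≤ awDeficiency s f a := fun a => by
    have := limsup_add_liminf_sub_le hT (h0 a) (hle a) (hC a)
    unfold deficiency awMultIndex awDeficiency
    linarith
  have hfin : ∀ U : Finset (WithTop ℂ), ∑ a ∈ U, awDeficiency s f a ≤ 2 := fun U => by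
    -- The bound is available for finite sets containing infinity. Adding that value to `U` does not
    -- decrease the sum, as all terms are nonnegative.
    set S := U.preimage ((↑) : ℂ → WithTop ℂ) WithTop.coe_injective.injOn with hS
    refine le_trans ?_ (sum_awDeficiency_le_two hs0 hs1 hf htr hord hD S)
    rw [← sum_insert_top_image_coe (fun a => awDeficiency s f a)]
    refine Finset.sum_le_sum_of_subset_of_nonneg ?_ fun a _ _ => hΘ a
    intro a ha
    induction a using WithTop.recTopCoe with
    | top => simp
    | coe a => simp [hS, ha]
  have hsum := summable_of_sum_le hΘ hfin
  have hsum' := Summable.of_nonneg_of_le hδ hδΘ hsum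
  refine ⟨hsum', hsum, hsum'.tsum_le_tsum hδΘ hsum, hsum.tsum_le_of_sum_le hfin, ?_⟩
  exact hsum.countable_support.mono fun a ha => (ne_of_gt ha : _)
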